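/- **Theorem (Oracle inequality).** Let $t\ge 1$, let $\mathcal Q_1,\dots,\mathcal Q_t$ be probability distributions on an interval $[a,b]$ with means $\mu_j$ and variances $\sigma_j^2$, let $B_1,\dots,B_t\ge 1$ be integers, and let $u_{j,i}$ ($1\le j\le t$, $1\le i\le B_j$) be mutually independent random variables with $u_{j,i}\sim\mathcal Q_j$. Put $M=b-a$ and, for $k\in[t]=\{1,\dots,t\}$, $B_{t,k}=\sum_{j=t-k+1}^t B_j$, $\sigma_{t,k}^2=B_{t,k}^{-1}\sum_{j=t-k+1}^t B_j\sigma_j^2$, $$\phi(t,k)=\max_{t-k+1\le j\le t}|\mu_j-\mu_t|,$$ $$\psi(t,k,\delta)=\begin{cases} M, & B_{t,k}=1,\\ \sigma_{t,k}\sqrt{\dfrac{2\log(2/\delta)}{B_{t,k}}}+\dfrac{2M\log(2/\delta)}{3B_{t,k}}, & B_{t,k}\ge 2.\end{cases}$$ Let $$\widehat\mu_{t,k}=\frac1{B_{t,k}}\sum_{j=t-k+1}^t\sum_{i=1}^{B_j}u_{j,i},\qquad \widehat v_{t,k}^2=\frac1{B_{t,k}-1}\sum_{j=t-k+1}^t\sum_{i=1}^{B_j}(u_{j,i}-\widehat\mu_{t,k})^2,$$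 $$\widehat\psi(t,k,\delta)=\begin{cases} M, & B_{t,k}=1,\\ \widehat v_{t,k}\sqrt{\dfrac{2\log(2/\delta)}{B_{t,k}}}+\dfrac{8M\log(2/\delta)}{3(B_{t,k}-1)}, & B_{t,k}\ge2,\end{cases}$$ $$\widehat\phi(t,k,\delta)=\max_{i\in[k]}\Big(|\widehat\mu_{t,k}-\widehat\mu_{t,i}|-\big[\widehat\psi(t,k,\delta)+\widehat\psi(t,i,\delta)\big]\Big)_+ .$$ Let $\delta\in(0,1)$ and $\delta'=\delta/(3t)$. The adaptive rolling-window algorithm selects any $\widehat k\in\operatorname{argmin}_{k\in[t]}\{\widehat\phi(t,k,\delta')+\widehat\psi(t,k,\delta')\}$ and outputs $\widehat\mu_{t,\widehat k}$. There is a universal constant $C>0$ (independent of $t$, $\delta$, $a$, $b$, the $B_j$ and the $\mathcal Q_j$) such that, with probability at least $1-\delta$, every such choice of $\widehat k$ satisfies $$|\widehat\mu_{t,\widehat k}-\mu_t|\le C\log(6t/\delta)\,\min_{k\in[t]}\{\phi(t,k)+\psi(t,k,\delta)\}.$$ More precisely, with probability at least $1-\delta$, every such choice of $\widehat k$ satisfies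 $$|\widehat\mu_{t,\widehat k}-\mu_t|\le 3\min_{k\in[t]}\left\{3\sqrt{\log(6t/\delta)}\,\phi(t,k)+\sigma_{t,k}\sqrt{\frac{2\log(6t/\delta)}{B_{t,k}}}+\frac{10(b-a)\log(6t/\delta)}{B_{t,k}}\right\}.$$ -/

import Mathlib

open MeasureTheory ProbabilityTheory

noncomputable section

namespace RollingWindow

/-- The periods `t - k + 1, …, t` in the look-back window of length `k` (for `1 ≤ k ≤ t`). -/
def window (t k : ℕ) : Finset ℕ := Finset.Icc (t - k + 1) t

/-- The pairs `⟨j, i⟩` with `1 ≤ j ≤ t` and `1 ≤ i ≤ B j` that index all samples up to time `t`. -/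
def sampleIndex (B : ℕ → ℕ) (t : ℕ) : Finset (Σ _ : ℕ, ℕ) :=
  (Finset.Icc 1 t).sigma fun j => Finset.Icc 1 (B j)

/-- `B_{t,k}`, the number of samples in the window. -/
def windowSize (B : ℕ → ℕ) (t k : ℕ) : ℕ := ∑ j ∈ window t k, B j

/-! ### Population quantities -/

/-- The mean `μ_j` of `Q_j`. -/
def popMean (Q : ℕ → Measure ℝ) (j : ℕ) : ℝ := ∫ x, x ∂(Q j)

/-- The averaged standard deviation `σ_{t,k}`, the square root of
`σ_{t,k}² = B_{t,k}⁻¹ ∑_{j=t-k+1}^t B_j σ_j²`, where `σ_j²` is the variance of `Q_j`. -/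
def popStd (Q : ℕ → Measure ℝ) (B : ℕ → ℕ) (t k : ℕ) : ℝ :=
  √((windowSize B t k : ℝ)⁻¹ * ∑ j ∈ window t k, (B j : ℝ) * variance (fun x : ℝ => x) (Q j))

/-- The drift `φ(t,k) = max_{t-k+1 ≤ j ≤ t} |μ_j - μ_t|`. -/
def phi (Q : ℕ → Measure ℝ) (t k : ℕ) : ℝ :=
  ⨆ j : window t k, |popMean Q j - popMean Q t|

/-- The Bernstein deviation term `ψ(t,k,δ)` for samples in an interval of length `M`. -/
def psi (Q : ℕ → Measure ℝ) (B : ℕ → ℕ) (M : ℝ) (t k : ℕ) (δ : ℝ) : ℝ :=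
  if windowSize B t k = 1 then M
  else popStd Q B t k * √(2 * Real.log (2 / δ) / windowSize B t k)
    + 2 * M * Real.log (2 / δ) / (3 * windowSize B t k)

/-! ### Quantities computed from the data `x j i`, `1 ≤ i ≤ B j` -/

/-- The window average `μ̂_{t,k}`. -/
def empMean (B : ℕ → ℕ) (x : ℕ → ℕ → ℝ) (t k : ℕ) : ℝ :=
  (windowSize B t k : ℝ)⁻¹ * ∑ j ∈ window t k, ∑ i ∈ Finset.Icc 1 (B j), x j i

/-- The sample standard deviation `v̂_{t,k}` over the window (used only if `B_{t,k} ≥ 2`). -/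
def empStd (B : ℕ → ℕ) (x : ℕ → ℕ → ℝ) (t k : ℕ) : ℝ :=
  √(((windowSize B t k : ℝ) - 1)⁻¹ *
    ∑ j ∈ window t k, ∑ i ∈ Finset.Icc 1 (B j), (x j i - empMean B x t k) ^ 2)

/-- The proxy `ψ̂(t,k,δ)`. -/
def psiHat (B : ℕ → ℕ) (x : ℕ → ℕ → ℝ) (M : ℝ) (t k : ℕ) (δ : ℝ) : ℝ :=
  if windowSize B t k = 1 then M
  else empStd B x t k * √(2 * Real.log (2 / δ) / windowSize B t k)
    + 8 * M * Real.log (2 / δ) / (3 * ((windowSize B t k : ℝ) - 1))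

/-- The proxy `φ̂(t,k,δ) = max_{i ∈ [k]} (|μ̂_{t,k} - μ̂_{t,i}| - [ψ̂(t,k,δ) + ψ̂(t,i,δ)])₊`. -/
def phiHat (B : ℕ → ℕ) (x : ℕ → ℕ → ℝ) (M : ℝ) (t k : ℕ) (δ : ℝ) : ℝ :=
  ⨆ i : Finset.Icc 1 k,
    max (|empMean B x t k - empMean B x t i| - (psiHat B x M t k δ + psiHat B x M t i δ)) 0

/-- The windows that the adaptive rolling-window algorithm with data `x` and hyperparameters
`δ'`, `M` may select: the minimizers of `φ̂(t,k,δ') + ψ̂(t,k,δ')` over `k ∈ [t]`.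
Its output is `empMean B x t k` for any one such `k`. -/
def selectedWindows (B : ℕ → ℕ) (x : ℕ → ℕ → ℝ) (M : ℝ) (t : ℕ) (δ' : ℝ) : Set ℕ :=
  {k | k ∈ Finset.Icc 1 t ∧ ∀ k' ∈ Finset.Icc 1 t,
    phiHat B x M t k δ' + psiHat B x M t k δ' ≤ phiHat B x M t k' δ' + psiHat B x M t k' δ'}

/-- The algorithm always has a window to select. -/
theorem selectedWindows_nonempty (B : ℕ → ℕ) (x : ℕ → ℕ → ℝ) (M : ℝ) {t : ℕ} (ht : 1 ≤ t)
    (δ' : ℝ) : (selectedWindows B x M t δ').Nonempty := by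
  obtain ⟨k, hk, h⟩ := Finset.exists_min_image (Finset.Icc 1 t)
    (fun k => phiHat B x M t k δ' + psiHat B x M t k δ') (Finset.nonempty_Icc.mpr ht)
  exact ⟨k, hk, h⟩

end RollingWindow

end

/-!
Fix a window with `n` samples. Bernstein's inequality bounds the deviation of the window average
from its mean by the population standard deviation, which is then traded for the sample standard
deviation. The latter step has to cope with non-identical distributions: the sample variance is the
average over pairs of the kernel `(x - y)² / 2`, and Hoeffding's decoupling writes such an average
as a mean over permutations of averages of `n / 2` independent terms, so by convexity of `exp` its
exponential moments are those of a sum of independent variables in a bounded interval. The resulting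
self-bounding estimate shows that the sample standard deviation is within `M √(L / (n - 1))` of the
root of its own expectation, and that expectation exceeds the average variance by at most twice the
squared drift.

So, simultaneously for all windows, `psiHat` dominates the stochastic error of `empMean` and is
itself at most a Bernstein radius plus a multiple of the drift. On this event the rest is the
deterministic Goldenshluger–Lepski argument: `phiHat` is at most twice the drift `phi`, and
minimality of `phiHat + psiHat` compares a selected window with any other one.
-/

namespace RollingWindow

section Bernstein

theorem exp_le_quadratic_of_nonpos {x : ℝ} (hx : x ≤ 0) : Real.exp x ≤ 1 + x + x ^ 2 / 2 := by
  have hquad := Real.quadratic_le_exp_of_nonneg (neg_nonneg.mpr hx)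
  have hpos : 0 < 1 + -x + (-x) ^ 2 / 2 := by nlinarith [sq_nonneg x]
  calc Real.exp x = (Real.exp (-x))⁻¹ := by rw [Real.exp_neg, inv_inv]
    _ ≤ (1 + -x + (-x) ^ 2 / 2)⁻¹ := inv_anti₀ hpos hquad
    _ ≤ 1 + x + x ^ 2 / 2 := by
        rw [inv_le_iff_one_le_mul₀ hpos]
        nlinarith [sq_nonneg (x ^ 2)]

theorem exp_le_one_add_add_sq_div {x c : ℝ} (hx : |x| ≤ c) (hc : c < 2) :
    Real.exp x ≤ 1 + x + x ^ 2 / (2 - c) := by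
  rcases le_total 0 x with h | h
  · rw [abs_of_nonneg h] at hx
    have hx2 : 0 < 2 - x := by linarith
    calc Real.exp x ≤ (2 + x) / (2 - x) := Real.exp_le_two_add_div_two_sub h (by linarith)
      _ = 1 + x + x ^ 2 / (2 - x) := by field_simp; ring
      _ ≤ 1 + x + x ^ 2 / (2 - c) := by gcongr
  · have hc0 : 0 ≤ c := (abs_nonneg x).trans hx
    refine (exp_le_quadratic_of_nonpos h).trans ?_
    gcongr
    linarith

variable {Ω : Type*} [MeasurableSpace Ω] {P : Measure Ω} [IsProbabilityMeasure P]

theorem integral_mem_Icc {Y : Ω → ℝ} {a b : ℝ} (hY : AEMeasurable Y P)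
    (hab : ∀ᵐ ω ∂P, Y ω ∈ Set.Icc a b) : ∫ ω, Y ω ∂P ∈ Set.Icc a b := by
  simpa only [probReal_univ, smul_eq_mul, one_mul, average_eq_integral] using
    (convex_Icc a b).average_mem isClosed_Icc hab (Integrable.of_mem_Icc a b hY hab)

theorem mgf_sub_integral_le {Y : Ω → ℝ} {a b l : ℝ} (hY : AEMeasurable Y P)
    (hab : ∀ᵐ ω ∂P, Y ω ∈ Set.Icc a b) (hl : 0 ≤ l) (hlab : l * (b - a) < 2) :
    mgf (fun ω => Y ω - P[Y]) P l ≤ Real.exp (l ^ 2 * Var[Y; P] / (2 - l * (b - a))) := by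
  set m := P[Y]
  have hm : m ∈ Set.Icc a b := integral_mem_Icc hY hab
  have hint : Integrable Y P := Integrable.of_mem_Icc a b hY hab
  have hcent : ∀ᵐ ω ∂P, Y ω - m ∈ Set.Icc (a - m) (b - m) := hab.mono fun ω h =>
    ⟨sub_le_sub_right h.1 m, sub_le_sub_right h.2 m⟩
  have hbound : ∀ᵐ ω ∂P, |l * (Y ω - m)| ≤ l * (b - a) := hab.mono fun ω h => by
    rw [abs_mul, abs_of_nonneg hl]
    gcongr
    rw [abs_le]
    constructor <;> linarith [h.1, h.2, hm.1, hm.2]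
  have hexp := integrable_exp_mul_of_mem_Icc (t := l) (hY.sub_const m) hcent
  have hdev : Integrable (fun ω => l * (Y ω - m)) P :=
    (hint.sub (integrable_const m)).const_mul l
  have hlin : Integrable (fun ω => 1 + l * (Y ω - m)) P := (integrable_const 1).add hdev
  have hquad : Integrable (fun ω => (Y ω - m) ^ 2) P :=
    (memLp_of_bounded hcent (hY.sub_const m).aestronglyMeasurable 2).integrable_sq
  calc mgf (fun ω => Y ω - m) P l
      ≤ ∫ ω, 1 + l * (Y ω - m) + l ^ 2 / (2 - l * (b - a)) * (Y ω - m) ^ 2 ∂P :=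
        integral_mono_ae hexp (hlin.add (hquad.const_mul _)) <| hbound.mono fun ω h => by
          simpa only [mul_pow, div_mul_eq_mul_div] using exp_le_one_add_add_sq_div h hlab
    _ = l ^ 2 * Var[Y; P] / (2 - l * (b - a)) + 1 := by
        rw [integral_add hlin (hquad.const_mul _), integral_add (integrable_const 1) hdev,
          integral_const_mul, integral_const_mul, integral_sub hint (integrable_const m),
          variance_eq_integral hY]
        simp only [integral_const, probReal_univ, one_smul, m]
        ring
    _ ≤ _ := Real.add_one_le_exp _

theorem measure_ge_le_exp_neg_of_mgf_le {Y : Ω → ℝ} {v M L : ℝ} (hv : 0 < v) (hM : 0 ≤ M)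
    (hL : 0 ≤ L) (hint : ∀ l, Integrable (fun ω => Real.exp (l * Y ω)) P)
    (hmgf : ∀ l, 0 ≤ l → l * M < 2 → mgf Y P l ≤ Real.exp (l ^ 2 * v / (2 - l * M))) :
    P.real {ω | √(2 * v * L) + M / 2 * L ≤ Y ω} ≤ Real.exp (-L) := by
  obtain ⟨w, hw, rfl⟩ : ∃ w, 0 < w ∧ v = w ^ 2 := ⟨√v, by positivity, (Real.sq_sqrt hv.le).symm⟩
  obtain ⟨r, hr, rfl⟩ : ∃ r, 0 ≤ r ∧ L = r ^ 2 / 2 :=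
    ⟨√(2 * L), by positivity, by rw [Real.sq_sqrt (by positivity)]; ring⟩
  have hsqrt : √(2 * w ^ 2 * (r ^ 2 / 2)) = w * r := by
    rw [show 2 * w ^ 2 * (r ^ 2 / 2) = (w * r) ^ 2 by ring, Real.sqrt_sq (by positivity)]
  set s := √(2 * w ^ 2 * (r ^ 2 / 2)) + M / 2 * (r ^ 2 / 2) with hs
  have : 0 < 2 * w + M * r := by positivity
  -- The minimiser of `l ↦ -l * s + l ^ 2 * v / (2 - l * M)`, at which the minimum is `-L`.
  set l := 2 * r / (2 * w + M * r) with hl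
  have hl0 : 0 ≤ l := by positivity
  have hgap : 2 - l * M = 4 * w / (2 * w + M * r) := by rw [hl]; field_simp; ring
  have hlM : l * M < 2 := sub_pos.mp (hgap ▸ by positivity)
  calc P.real {ω | s ≤ Y ω}
      ≤ Real.exp (-l * s) * mgf Y P l := measure_ge_le_exp_mul_mgf s hl0 (hint l)
    _ ≤ Real.exp (-l * s) * Real.exp (l ^ 2 * w ^ 2 / (2 - l * M)) := by
        gcongr
        exact hmgf l hl0 hlM
    _ = Real.exp (-(r ^ 2 / 2)) := by
        rw [← Real.exp_add, hgap, hs, hsqrt, hl]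
        congr 1
        field_simp
        ring

variable {ι : Type*} [Fintype ι] {X : ι → Ω → ℝ} {a b : ℝ}

theorem ae_sum_sub_integral_eq_zero (hX : ∀ i, MemLp (X i) 2 P)
    (hvar : ∑ i, Var[X i; P] = 0) : ∀ᵐ ω ∂P, ∑ i, (X i ω - P[X i]) = 0 := by
  have hvar_eq : ∀ i, Var[X i; P] = 0 := fun i =>
    (Finset.sum_eq_zero_iff_of_nonneg fun i _ => variance_nonneg (X i) P).mp hvar i
      (Finset.mem_univ i)
  have hae : ∀ᵐ ω ∂P, ∀ i, X i ω = P[X i] :=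
    ae_all_iff.mpr fun i => ae_eq_integral_of_variance_eq_zero (hX i) (hvar_eq i)
  exact hae.mono fun ω h => Finset.sum_eq_zero fun i _ => sub_eq_zero.mpr (h i)

theorem measure_sum_sub_integral_gt_le (hX : ∀ i, AEMeasurable (X i) P)
    (hXab : ∀ i, ∀ᵐ ω ∂P, X i ω ∈ Set.Icc a b) (hind : iIndepFun X P) (hab : a ≤ b)
    {L : ℝ} (hL : 0 ≤ L) :
    P.real {ω | √(2 * (∑ i, Var[X i; P]) * L) + (b - a) / 2 * L < ∑ i, (X i ω - P[X i])} ≤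
      Real.exp (-L) := by
  have hM : 0 ≤ b - a := sub_nonneg.mpr hab
  rcases (Finset.sum_nonneg fun i _ => variance_nonneg (X i) P :
    0 ≤ ∑ i, Var[X i; P]).eq_or_lt with hv | hv
  · have hnull : P {ω | √(2 * (∑ i, Var[X i; P]) * L) + (b - a) / 2 * L <
        ∑ i, (X i ω - P[X i])} = 0 := by
      refine measure_eq_zero_iff_ae_notMem.mpr ?_
      filter_upwards [ae_sum_sub_integral_eq_zero
        (fun i => memLp_of_bounded (hXab i) (hX i).aestronglyMeasurable 2) hv.symm] with ω h0
      simp only [h0, not_lt]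
      positivity
    rw [measureReal_def, hnull]
    exact (Real.exp_pos _).le
  have hcent : ∀ i, AEMeasurable (fun ω => X i ω - P[X i]) P := fun i => (hX i).sub_const _
  have hcentInd : iIndepFun (fun i ω => X i ω - P[X i]) P :=
    hind.comp (fun i x => x - ∫ ω, X i ω ∂P) fun i => measurable_id.sub_const _
  refine (measureReal_mono (Set.ofPred_subset_ofPred.mpr fun ω hω => hω.le)).trans
    (measure_ge_le_exp_neg_of_mgf_le hv hM hL (fun l => ?_) fun l hl hlM => ?_)
  · refine integrable_exp_mul_of_mem_Icc (a := ∑ i, (a - P[X i])) (b := ∑ i, (b - P[X i]))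
      (Finset.aemeasurable_fun_sum _ fun i _ => hcent i) ?_
    filter_upwards [ae_all_iff.mpr hXab] with ω h
    exact ⟨Finset.sum_le_sum fun i _ => sub_le_sub_right (h i).1 _,
      Finset.sum_le_sum fun i _ => sub_le_sub_right (h i).2 _⟩
  · have hprod := hcentInd.mgf_sum₀ (t := l) hcent Finset.univ
    rw [Finset.sum_fn] at hprod
    rw [hprod, Finset.mul_sum, Finset.sum_div, Real.exp_sum]
    exact Finset.prod_le_prod (fun i _ => mgf_nonneg)
      fun i _ => mgf_sub_integral_le (hX i) (hXab i) hl hlM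

theorem measure_abs_sum_sub_integral_gt_le (hX : ∀ i, AEMeasurable (X i) P)
    (hXab : ∀ i, ∀ᵐ ω ∂P, X i ω ∈ Set.Icc a b) (hind : iIndepFun X P) (hab : a ≤ b)
    {L : ℝ} (hL : 0 ≤ L) :
    P.real {ω | √(2 * (∑ i, Var[X i; P]) * L) + (b - a) / 2 * L < |∑ i, (X i ω - P[X i])|} ≤
      2 * Real.exp (-L) := by
  have hupper := measure_sum_sub_integral_gt_le hX hXab hind hab hL
  have hlower := measure_sum_sub_integral_gt_le (X := fun i ω => -X i ω) (a := -b) (b := -a)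
    (fun i => (hX i).neg) (fun i => (hXab i).mono fun ω h => ⟨neg_le_neg h.2, neg_le_neg h.1⟩)
    (hind.comp (fun _ x => -x) fun _ => measurable_neg) (neg_le_neg hab) hL
  simp only [variance_fun_neg, integral_neg, neg_sub_neg, ← neg_sub (X _ _),
    Finset.sum_neg_distrib] at hlower
  simp only [lt_abs, Set.ofPred_or]
  rw [two_mul (Real.exp _)]
  exact (measureReal_union_le _ _).trans (add_le_add hupper hlower)

end Bernstein

section PairAverage

open scoped BigOperators

variable {ι : Type*} [Fintype ι]

/-- The average of `f` over the ordered pairs of distinct indices: a U-statistic of order two when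
`f i j` is a kernel evaluated at the `i`-th and `j`-th observations. -/
noncomputable def pairAverage (f : ι → ι → ℝ) : ℝ :=
  𝔼 p ∈ Finset.univ.offDiag, f p.1 p.2

theorem pairAverage_comp_perm (f : ι → ι → ℝ) (σ : Equiv.Perm ι) :
    pairAverage (fun i j => f (σ i) (σ j)) = pairAverage f :=
  Finset.expect_equiv (Equiv.prodCongr σ σ) (by simp) fun _ _ => rfl

variable [DecidableEq ι]

theorem expect_perm_eq_pairAverage (f : ι → ι → ℝ) {a b : ι} (hab : a ≠ b) :
    𝔼 σ : Equiv.Perm ι, f (σ a) (σ b) = pairAverage f := by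
  have htrans : ∀ p ∈ (Finset.univ : Finset ι).offDiag,
      𝔼 σ : Equiv.Perm ι, f (σ p.1) (σ p.2) = 𝔼 σ : Equiv.Perm ι, f (σ a) (σ b) := by
    rintro ⟨c, d⟩ hcd
    obtain ⟨τ, rfl, rfl⟩ := MulAction.is_two_pretransitive_iff.mp
      (Equiv.Perm.isMultiplyPretransitive ι 2) hab (Finset.mem_offDiag.mp hcd).2.2
    exact Fintype.expect_equiv (Equiv.mulRight τ) _ _ fun _ => rfl
  have hne : (Finset.univ : Finset ι).offDiag.Nonempty := ⟨(a, b), by simpa using hab⟩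
  calc 𝔼 σ : Equiv.Perm ι, f (σ a) (σ b)
      = 𝔼 p ∈ Finset.univ.offDiag, 𝔼 σ : Equiv.Perm ι, f (σ p.1) (σ p.2) := by
        rw [Finset.expect_congr rfl htrans, Finset.expect_const hne]
    _ = 𝔼 σ : Equiv.Perm ι, pairAverage fun i j => f (σ i) (σ j) := Finset.expect_comm _ _ _
    _ = pairAverage f := by simp only [pairAverage_comp_perm, Fintype.expect_const]

theorem card_mul_pairAverage_eq {m : ℕ} (f : ι → ι → ℝ) (e : Fin m × Bool ↪ ι) :
    m * pairAverage f =
      𝔼 σ : Equiv.Perm ι, ∑ l, f (σ (e (l, false))) (σ (e (l, true))) := by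
  rw [Finset.expect_sum_comm, Finset.sum_congr rfl fun l _ =>
    expect_perm_eq_pairAverage f (e.injective.ne (by simp : (l, false) ≠ (l, true)))]
  simp

theorem exp_expect_le {κ : Type*} [Fintype κ] [Nonempty κ] (g : κ → ℝ) :
    Real.exp (𝔼 k, g k) ≤ 𝔼 k, Real.exp (g k) := by
  have hsum : ∑ _k : κ, (Fintype.card κ : ℝ)⁻¹ = 1 := by simp
  simpa only [smul_eq_mul, Fintype.expect_eq_sum_div_card, div_eq_inv_mul, Finset.mul_sum] using
    convexOn_exp.map_sum_le (p := g) (fun _ _ => by positivity) hsum fun _ _ => Set.mem_univ _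

end PairAverage

section PairIndependence

variable {Ω E κ τ : Type*} [MeasurableSpace Ω] [MeasurableSpace E] {P : Measure Ω}

theorem lintegral_prod_eq_prod_lintegral {Y : κ → Ω → ENNReal} (hY : ∀ k, AEMeasurable (Y k) P)
    (hind : iIndepFun Y P) (s : Finset κ) :
    ∫⁻ ω, ∏ k ∈ s, Y k ω ∂P = ∏ k ∈ s, ∫⁻ ω, Y k ω ∂P := by
  have hmk : ∀ᵐ ω ∂P, ∀ k ∈ s, Y k ω = (hY k).mk (Y k) ω :=
    (Filter.eventually_all_finset s).mpr fun k _ => (hY k).ae_eq_mk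
  calc ∫⁻ ω, ∏ k ∈ s, Y k ω ∂P = ∫⁻ ω, ∏ k ∈ s, (hY k).mk (Y k) ω ∂P :=
        lintegral_congr_ae (hmk.mono fun ω h => Finset.prod_congr rfl h)
    _ = ∏ k ∈ s, ∫⁻ ω, (hY k).mk (Y k) ω ∂P :=
        lintegral_prod_eq_prod_lintegral_of_indepFun s _
          (hind.congr fun k => (hY k).ae_eq_mk) fun k => (hY k).measurable_mk
    _ = ∏ k ∈ s, ∫⁻ ω, Y k ω ∂P :=
        Finset.prod_congr rfl fun k _ => lintegral_congr_ae (hY k).ae_eq_mk.symm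

variable [IsProbabilityMeasure P]

theorem iIndepFun_curry [Countable κ] [Countable τ] {X : κ × τ → Ω → E}
    (hX : ∀ p, AEMeasurable (X p) P) (hind : iIndepFun X P) :
    iIndepFun (fun k ω c => X (k, c) ω) P := by
  have hprob : ∀ p, IsProbabilityMeasure (P.map (X p)) := fun p =>
    Measure.isProbabilityMeasure_map (hX p)
  have hrow : ∀ k, iIndepFun (fun c => X (k, c)) P := fun k =>
    hind.precomp (Prod.mk_right_injective k)
  have hmeas : AEMeasurable (fun ω p => X p ω) P := aemeasurable_pi_lambda _ hX
  have hrowMeas : ∀ k, AEMeasurable (fun ω c => X (k, c) ω) P := fun k =>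
    aemeasurable_pi_lambda _ fun c => hX (k, c)
  rw [iIndepFun_iff_map_fun_eq_infinitePi_map₀' hrowMeas]
  calc P.map (fun ω k c => X (k, c) ω)
      = (P.map fun ω p => X p ω).map (MeasurableEquiv.curry κ τ E) := by
        rw [AEMeasurable.map_map_of_aemeasurable
          (MeasurableEquiv.measurable _).aemeasurable hmeas]
        rfl
    _ = Measure.infinitePi fun k => Measure.infinitePi fun c => P.map (X (k, c)) := by
        rw [(iIndepFun_iff_map_fun_eq_infinitePi_map₀' hX).mp hind]
        exact Measure.infinitePi_map_curry fun k c => P.map (X (k, c))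
    _ = Measure.infinitePi fun k => P.map fun ω c => X (k, c) ω := by
        congr! 2 with k
        exact ((iIndepFun_iff_map_fun_eq_infinitePi_map₀' fun c => hX (k, c)).mp (hrow k)).symm

variable {ι : Type*} {X : ι → Ω → E} {F : ι → ι → E → E → ℝ}

theorem lintegral_exp_sum_pairs_le_one [Fintype κ] (hX : ∀ i, AEMeasurable (X i) P)
    (hind : iIndepFun X P) (hF : ∀ i j, Measurable (F i j).uncurry)
    (hexp : ∀ i j, i ≠ j → ∫⁻ ω, ENNReal.ofReal (Real.exp (F i j (X i ω) (X j ω))) ∂P ≤ 1)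
    (e : κ × Bool ↪ ι) :
    ∫⁻ ω, ENNReal.ofReal (Real.exp (∑ k, F (e (k, false)) (e (k, true))
      (X (e (k, false)) ω) (X (e (k, true)) ω))) ∂P ≤ 1 := by
  set Y : κ → Ω → ENNReal := fun k ω => ENNReal.ofReal (Real.exp
    (F (e (k, false)) (e (k, true)) (X (e (k, false)) ω) (X (e (k, true)) ω)))
  have hY : ∀ k, AEMeasurable (Y k) P := fun k =>
    (Real.measurable_exp.comp_aemeasurable
      ((hF _ _).comp_aemeasurable ((hX _).prodMk (hX _)))).ennreal_ofReal
  have hpair : Measurable fun x : Bool → E => (x false, x true) :=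
    (measurable_pi_apply false).prodMk (measurable_pi_apply true)
  have hindY : iIndepFun Y P :=
    (iIndepFun_curry (fun p => hX (e p)) (hind.precomp e.injective)).comp
      (fun k x => ENNReal.ofReal (Real.exp
        (F (e (k, false)) (e (k, true)) (x false) (x true))))
      fun k => (Real.measurable_exp.comp ((hF _ _).comp hpair)).ennreal_ofReal
  calc ∫⁻ ω, ENNReal.ofReal (Real.exp (∑ k, F (e (k, false)) (e (k, true))
          (X (e (k, false)) ω) (X (e (k, true)) ω))) ∂P
      = ∫⁻ ω, ∏ k, Y k ω ∂P := by
        simp only [Y, Real.exp_sum, ENNReal.ofReal_prod_of_nonneg fun _ _ => (Real.exp_nonneg _)]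
    _ = ∏ k, ∫⁻ ω, Y k ω ∂P := lintegral_prod_eq_prod_lintegral hY hindY _
    _ ≤ 1 := Finset.prod_le_one' fun k _ => hexp _ _ (e.injective.ne (by simp))

-- Hoeffding's decoupling: a U-statistic is an average, over permutations of the sample, of sums
-- over disjoint pairs, whose summands are independent.
theorem lintegral_exp_mul_pairAverage_le_one [Fintype ι] (hX : ∀ i, AEMeasurable (X i) P)
    (hind : iIndepFun X P) (hF : ∀ i j, Measurable (F i j).uncurry)
    (hexp : ∀ i j, i ≠ j → ∫⁻ ω, ENNReal.ofReal (Real.exp (F i j (X i ω) (X j ω))) ∂P ≤ 1)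
    {m : ℕ} (hm : 2 * m ≤ Fintype.card ι) :
    ∫⁻ ω, ENNReal.ofReal (Real.exp (m * pairAverage fun i j => F i j (X i ω) (X j ω))) ∂P ≤ 1 := by
  classical
  obtain ⟨e⟩ : Nonempty (Fin m × Bool ↪ ι) :=
    Function.Embedding.nonempty_of_card_le (by simpa [mul_comm] using hm)
  set S : Equiv.Perm ι → Ω → ℝ := fun σ ω => ∑ k, F (σ (e (k, false))) (σ (e (k, true)))
    (X (σ (e (k, false))) ω) (X (σ (e (k, true))) ω)
  have hS : ∀ σ, AEMeasurable (fun ω => ENNReal.ofReal (Real.exp (S σ ω))) P := fun σ =>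
    (Real.measurable_exp.comp_aemeasurable (Finset.aemeasurable_fun_sum _ fun k _ =>
      (hF _ _).comp_aemeasurable ((hX _).prodMk (hX _)))).ennreal_ofReal
  have hJensen : ∀ ω, ENNReal.ofReal
      (Real.exp (m * pairAverage fun i j => F i j (X i ω) (X j ω))) ≤
      (∑ σ, ENNReal.ofReal (Real.exp (S σ ω))) / Fintype.card (Equiv.Perm ι) := fun ω => by
    rw [card_mul_pairAverage_eq _ e, ← ENNReal.ofReal_sum_of_nonneg fun _ _ => Real.exp_nonneg _,
      ← ENNReal.ofReal_natCast, ← ENNReal.ofReal_div_of_pos (by simp [Fintype.card_pos]),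
      ← Fintype.expect_eq_sum_div_card]
    exact ENNReal.ofReal_le_ofReal (exp_expect_le _)
  calc ∫⁻ ω, ENNReal.ofReal (Real.exp (m * pairAverage fun i j => F i j (X i ω) (X j ω))) ∂P
      ≤ ∫⁻ ω, (∑ σ, ENNReal.ofReal (Real.exp (S σ ω))) / Fintype.card (Equiv.Perm ι) ∂P :=
        lintegral_mono hJensen
    _ = (∑ σ, ∫⁻ ω, ENNReal.ofReal (Real.exp (S σ ω)) ∂P) / Fintype.card (Equiv.Perm ι) := by
        simp only [div_eq_mul_inv]
        rw [lintegral_mul_const' _ _ (by simp), lintegral_finsetSum' _ fun σ _ => hS σ]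
    _ ≤ (∑ _σ : Equiv.Perm ι, 1) / Fintype.card (Equiv.Perm ι) := by
        gcongr with σ
        exact lintegral_exp_sum_pairs_le_one hX hind hF hexp (e.trans σ.toEmbedding)
    _ ≤ 1 := by simp [ENNReal.div_self_le_one]

end PairIndependence

section RootConcentration

theorem exp_mul_le_one_add_mul {x η : ℝ} (hx : x ∈ Set.Icc (0 : ℝ) 1) :
    Real.exp (η * x) ≤ 1 + (Real.exp η - 1) * x := by
  have h := convexOn_exp.2 (Set.mem_univ 0) (Set.mem_univ η) (sub_nonneg.mpr hx.2) hx.1 (by ring)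
  simp only [smul_eq_mul, mul_zero, zero_add, Real.exp_zero, mul_one] at h
  calc Real.exp (η * x) = Real.exp (x * η) := by rw [mul_comm]
    _ ≤ 1 - x + x * Real.exp η := h
    _ = 1 + (Real.exp η - 1) * x := by ring

theorem sq_sub_le_log_mul_sq_sub {s x : ℝ} (hs : 0 < s) (hx : 0 < x) :
    (x - s) ^ 2 ≤ Real.log (x / s) * x ^ 2 - (x / s - 1) * s ^ 2 := by
  have hlog : 1 - (x / s)⁻¹ ≤ Real.log (x / s) := Real.one_sub_inv_le_log_of_pos (div_pos hx hs)
  calc (x - s) ^ 2 = (1 - (x / s)⁻¹) * x ^ 2 - (x / s - 1) * s ^ 2 := by field_simp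
    _ ≤ Real.log (x / s) * x ^ 2 - (x / s - 1) * s ^ 2 := by gcongr

variable {Ω : Type*} [MeasurableSpace Ω] {P : Measure Ω}

theorem lintegral_exp_mul_sub_le_one [IsProbabilityMeasure P] {Y : Ω → ℝ} (hY : AEMeasurable Y P)
    (hY01 : ∀ᵐ ω ∂P, Y ω ∈ Set.Icc 0 1) (η : ℝ) :
    ∫⁻ ω, ENNReal.ofReal (Real.exp (η * Y ω - (Real.exp η - 1) * P[Y])) ∂P ≤ 1 := by
  have hint : Integrable Y P := Integrable.of_mem_Icc 0 1 hY hY01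
  have hlin : Integrable (fun ω => (Real.exp η - 1) * Y ω) P := hint.const_mul _
  have hbound : ∀ᵐ ω ∂P, Real.exp (η * Y ω - (Real.exp η - 1) * P[Y]) ≤
      Real.exp (-((Real.exp η - 1) * P[Y])) * (1 + (Real.exp η - 1) * Y ω) :=
    hY01.mono fun ω h => by
      rw [sub_eq_neg_add, Real.exp_add]
      exact mul_le_mul_of_nonneg_left (exp_mul_le_one_add_mul h) (Real.exp_nonneg _)
  have hboundInt : Integrable (fun ω => Real.exp (-((Real.exp η - 1) * P[Y])) *
      (1 + (Real.exp η - 1) * Y ω)) P := ((integrable_const 1).add hlin).const_mul _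
  refine (lintegral_mono_ae (hbound.mono fun ω => ENNReal.ofReal_le_ofReal)).trans ?_
  rw [← ofReal_integral_eq_lintegral_ofReal hboundInt
    (hbound.mono fun ω h => (Real.exp_nonneg _).trans h), ENNReal.ofReal_le_one,
    integral_const_mul, integral_add (integrable_const 1) hlin, integral_const_mul]
  simp only [integral_const, probReal_univ, one_smul]
  rw [Real.exp_neg, inv_mul_le_iff₀ (Real.exp_pos _), mul_one, add_comm]
  exact Real.add_one_le_exp _

variable {Y : Ω → ℝ} {c : ℝ}

theorem measure_log_mul_sub_sq_nonneg_le {x : ℝ} (hY : AEMeasurable Y P) (hc : 0 ≤ c)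
    (hmgf : ∀ η, ∫⁻ ω, ENNReal.ofReal
      (Real.exp (c * (η * Y ω - (Real.exp η - 1) * P[Y]))) ∂P ≤ 1)
    (hpos : 0 < P[Y]) (hx : 0 < x) :
    P.real {ω | 0 ≤ Real.log (x / √P[Y]) * (Y ω - x ^ 2)} ≤
      Real.exp (-(c * (x - √P[Y]) ^ 2)) := by
  set u := P[Y]
  have hs : 0 < √u := Real.sqrt_pos.mpr hpos
  set η := Real.log (x / √u)
  have hη : Real.exp η = x / √u := Real.exp_log (div_pos hx hs)
  have hsub : {ω | 0 ≤ η * (Y ω - x ^ 2)} ⊆ {ω | ENNReal.ofReal (Real.exp (c * (x - √u) ^ 2)) ≤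
      ENNReal.ofReal (Real.exp (c * (η * Y ω - (Real.exp η - 1) * u)))} := fun ω hω => by
    refine ENNReal.ofReal_le_ofReal (Real.exp_le_exp.mpr (mul_le_mul_of_nonneg_left ?_ hc))
    have hkey : (x - √u) ^ 2 ≤ η * x ^ 2 - (x / √u - 1) * u := by
      simpa only [Real.sq_sqrt hpos.le] using sq_sub_le_log_mul_sq_sub hs hx
    have hgap : 0 ≤ η * (Y ω - x ^ 2) := hω
    rw [hη]
    linarith
  have hmeas : AEMeasurable (fun ω => ENNReal.ofReal
      (Real.exp (c * (η * Y ω - (Real.exp η - 1) * u)))) P :=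
    (Real.measurable_exp.comp_aemeasurable
      (((hY.const_mul η).sub_const _).const_mul c)).ennreal_ofReal
  have hMarkov := meas_ge_le_lintegral_div hmeas
    (ENNReal.ofReal_pos.mpr (Real.exp_pos (c * (x - √u) ^ 2))).ne' ENNReal.ofReal_ne_top
  refine ENNReal.toReal_le_of_le_ofReal (Real.exp_nonneg _)
    ((measure_mono hsub).trans (hMarkov.trans ?_))
  rw [Real.exp_neg, ENNReal.ofReal_inv_of_pos (Real.exp_pos _), ← one_div]
  gcongr
  exact hmgf η

theorem measure_abs_sqrt_sub_sqrt_gt_le [IsFiniteMeasure P] {r : ℝ} (hY : AEMeasurable Y P)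
    (hc : 0 ≤ c)
    (hmgf : ∀ η, ∫⁻ ω, ENNReal.ofReal
      (Real.exp (c * (η * Y ω - (Real.exp η - 1) * P[Y]))) ∂P ≤ 1)
    (hpos : 0 < P[Y]) (hr : 0 ≤ r) :
    P.real {ω | r < |√(Y ω) - √P[Y]|} ≤ 2 * Real.exp (-(c * r ^ 2)) := by
  have hs : 0 < √P[Y] := Real.sqrt_pos.mpr hpos
  have hupper : P.real {ω | r < √(Y ω) - √P[Y]} ≤ Real.exp (-(c * r ^ 2)) := by
    have hx : 0 < √P[Y] + r := by positivity
    refine (measureReal_mono (Set.ofPred_subset_ofPred.mpr fun ω hω => ?_)).trans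
      ((measure_log_mul_sub_sq_nonneg_le hY hc hmgf hpos hx).trans_eq (by rw [add_sub_cancel_left]))
    refine mul_nonneg (Real.log_nonneg ((one_le_div hs).mpr (by linarith))) (sub_nonneg.mpr ?_)
    exact ((Real.lt_sqrt hx.le).mp (by linarith)).le
  have hlower : P.real {ω | r < √P[Y] - √(Y ω)} ≤ Real.exp (-(c * r ^ 2)) := by
    rcases le_or_gt (√P[Y] - r) 0 with h0 | hx
    · have hempty : {ω | r < √P[Y] - √(Y ω)} = ∅ := Set.eq_empty_of_forall_notMem fun ω hω => by
        have hgap : r < √P[Y] - √(Y ω) := hω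
        linarith [Real.sqrt_nonneg (Y ω)]
      rw [hempty, measureReal_empty]
      exact Real.exp_nonneg _
    · refine (measureReal_mono (Set.ofPred_subset_ofPred.mpr fun ω hω => ?_)).trans
        ((measure_log_mul_sub_sq_nonneg_le hY hc hmgf hpos hx).trans_eq
          (by rw [sub_sub_cancel_left, neg_sq]))
      refine mul_nonneg_of_nonpos_of_nonpos
        (Real.log_nonpos (by positivity) ((div_le_one hs).mpr (by linarith))) (sub_nonpos.mpr ?_)
      exact ((Real.sqrt_lt' hx).mp (by linarith)).le
  simp only [lt_abs, neg_sub, Set.ofPred_or]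
  rw [two_mul]
  exact (measureReal_union_le _ _).trans (add_le_add hupper hlower)

end RootConcentration

section PairAverageConcentration

theorem pairAverage_mem_Icc {ι : Type*} [Fintype ι] {f : ι → ι → ℝ} {a b : ℝ}
    (hn : 2 ≤ Fintype.card ι) (hf : ∀ i j, i ≠ j → f i j ∈ Set.Icc a b) :
    pairAverage f ∈ Set.Icc a b := by
  have hne : (Finset.univ : Finset ι).offDiag.Nonempty := by
    obtain ⟨i, j, hij⟩ := Fintype.one_lt_card_iff.mp hn
    exact ⟨(i, j), by simpa using hij⟩
  exact ⟨Finset.le_expect hne fun p hp => (hf _ _ (Finset.mem_offDiag.mp hp).2.2).1,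
    Finset.expect_le hne fun p hp => (hf _ _ (Finset.mem_offDiag.mp hp).2.2).2⟩

variable {Ω E ι : Type*} [MeasurableSpace Ω] [MeasurableSpace E] [Fintype ι] {P : Measure Ω}
  {X : ι → Ω → E} {f : E → E → ℝ}

theorem integral_pairAverage {g : ι → ι → Ω → ℝ}
    (hg : ∀ i j, i ≠ j → Integrable (g i j) P) :
    ∫ ω, pairAverage (fun i j => g i j ω) ∂P = pairAverage fun i j => P[g i j] := by
  simp only [pairAverage, Finset.expect_eq_sum_div_card]
  rw [integral_div, integral_finsetSum _ fun p hp => hg _ _ (Finset.mem_offDiag.mp hp).2.2]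

theorem aemeasurable_pairAverage {g : ι → ι → Ω → ℝ} (hg : ∀ i j, AEMeasurable (g i j) P) :
    AEMeasurable (fun ω => pairAverage fun i j => g i j ω) P := by
  simp only [pairAverage, Finset.expect_eq_sum_div_card]
  exact (Finset.aemeasurable_fun_sum _ fun p _ => hg _ _).div_const _

variable [IsProbabilityMeasure P]

theorem lintegral_exp_pairAverage_sub_integral_le_one (hX : ∀ i, AEMeasurable (X i) P)
    (hind : iIndepFun X P) (hf : Measurable f.uncurry) {H : ℝ}
    (hfH : ∀ i j, i ≠ j → ∀ᵐ ω ∂P, f (X i ω) (X j ω) ∈ Set.Icc 0 H)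
    {m : ℕ} (hm : 2 * m ≤ Fintype.card ι) (η : ℝ) :
    ∫⁻ ω, ENNReal.ofReal (Real.exp (m / H * (η * (pairAverage fun i j => f (X i ω) (X j ω)) -
      (Real.exp η - 1) * ∫ ω', pairAverage (fun i j => f (X i ω') (X j ω')) ∂P))) ∂P ≤ 1 := by
  have hmeas : ∀ i j, AEMeasurable (fun ω => f (X i ω) (X j ω)) P := fun i j =>
    hf.comp_aemeasurable ((hX i).prodMk (hX j))
  have hscaled : ∀ i j, i ≠ j → ∀ᵐ ω ∂P, f (X i ω) (X j ω) / H ∈ Set.Icc 0 1 :=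
    fun i j hij => (hfH i j hij).mono fun ω h =>
      ⟨div_nonneg h.1 (h.1.trans h.2), div_le_one_of_le₀ h.2 (h.1.trans h.2)⟩
  have hpair := lintegral_exp_mul_pairAverage_le_one hX hind
    (F := fun i j x y => η * (f x y / H) - (Real.exp η - 1) * ∫ ω, f (X i ω) (X j ω) / H ∂P)
    (fun i j => ((hf.div_const H).const_mul η).sub_const _)
    (fun i j hij => lintegral_exp_mul_sub_le_one ((hmeas i j).div_const H) (hscaled i j hij) η) hm
  refine (lintegral_congr fun ω => ?_).trans_le hpair
  rw [integral_pairAverage fun i j hij => Integrable.of_mem_Icc 0 H (hmeas i j) (hfH i j hij)]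
  simp only [pairAverage, integral_div, Finset.expect_sub_distrib, ← Finset.mul_expect,
    ← Finset.expect_div]
  congr 2
  ring

theorem measure_abs_sqrt_pairAverage_sub_gt_le (hX : ∀ i, AEMeasurable (X i) P)
    (hind : iIndepFun X P) (hf : Measurable f.uncurry) {H : ℝ}
    (hfH : ∀ i j, i ≠ j → ∀ᵐ ω ∂P, f (X i ω) (X j ω) ∈ Set.Icc 0 H)
    {m : ℕ} (hm0 : 0 < m) (hm : 2 * m ≤ Fintype.card ι) {L : ℝ} (hL : 0 ≤ L) :
    P.real {ω | √(H * L / m) < |√(pairAverage fun i j => f (X i ω) (X j ω)) -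
      √(∫ ω', pairAverage (fun i j => f (X i ω') (X j ω')) ∂P)|} ≤ 2 * Real.exp (-L) := by
  set U : Ω → ℝ := fun ω => pairAverage fun i j => f (X i ω) (X j ω)
  have hU : AEMeasurable U P := aemeasurable_pairAverage fun i j =>
    hf.comp_aemeasurable ((hX i).prodMk (hX j))
  have hUH : ∀ᵐ ω ∂P, U ω ∈ Set.Icc 0 H := by
    filter_upwards [ae_all_iff.mpr fun i => ae_all_iff.mpr fun j =>
      ae_all_iff.mpr (hfH i j)] with ω h
    exact pairAverage_mem_Icc (by omega) h
  obtain ⟨hu0, huH⟩ := integral_mem_Icc hU hUH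
  rcases hu0.eq_or_lt with hu | hu
  · have hzero : U =ᵐ[P] 0 := (integral_eq_zero_iff_of_nonneg_ae (hUH.mono fun ω h => h.1)
      (Integrable.of_mem_Icc 0 H hU hUH)).mp hu.symm
    have hnull : P {ω | √(H * L / m) < |√(U ω) - √P[U]|} = 0 := by
      refine measure_eq_zero_iff_ae_notMem.mpr (hzero.mono fun ω h => ?_)
      have hroot : √(U ω) = √P[U] := by rw [h, ← hu, Pi.zero_apply]
      simp only [Set.mem_ofPred_eq, hroot, sub_self, abs_zero, not_lt]
      positivity
    rw [measureReal_def, hnull]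
    positivity
  · have hH : 0 < H := hu.trans_le huH
    have hrate : m / H * √(H * L / m) ^ 2 = L := by
      rw [Real.sq_sqrt (by positivity)]
      field_simp
    simpa only [hrate] using measure_abs_sqrt_sub_sqrt_gt_le (c := m / H) hU (by positivity)
      (lintegral_exp_pairAverage_sub_integral_le_one hX hind hf hfH hm) hu
      (Real.sqrt_nonneg (H * L / m))

end PairAverageConcentration

section SampleVariance

open scoped BigOperators

variable {ι : Type*} [Fintype ι]

/-- The unbiased sample variance of the observations `x`, with denominator `n - 1`; it is `0` for
`n = 1`. -/
noncomputable def sampleVar (x : ι → ℝ) : ℝ :=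
  (∑ i, (x i - 𝔼 j, x j) ^ 2) / ((Fintype.card ι : ℝ) - 1)

theorem pairAverage_eq_sum_div (f : ι → ι → ℝ) :
    pairAverage f =
      (∑ i, ∑ j, f i j - ∑ i, f i i) / ((Fintype.card ι : ℝ) * ((Fintype.card ι : ℝ) - 1)) := by
  classical
  have hcard : ((Finset.univ : Finset ι).offDiag.card : ℝ) =
      (Fintype.card ι : ℝ) * ((Fintype.card ι : ℝ) - 1) := by
    rw [Finset.offDiag_card, Nat.cast_sub (Nat.le_mul_self _), Finset.card_univ]
    push_cast
    ring
  have hsum : ∑ i, ∑ j, f i j = ∑ i, f i i + ∑ p ∈ Finset.univ.offDiag, f p.1 p.2 := by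
    rw [← Finset.sum_product', ← Finset.diag_union_offDiag,
      Finset.sum_union (Finset.disjoint_diag_offDiag _), Finset.sum_diag]
  rw [pairAverage, Finset.expect_eq_sum_div_card, hcard, hsum, add_sub_cancel_left]

theorem sampleVar_eq_pairAverage (x : ι → ℝ) :
    sampleVar x = pairAverage fun i j => (x i - x j) ^ 2 / 2 := by
  rcases isEmpty_or_nonempty ι with hι | hι
  · simp [sampleVar, pairAverage_eq_sum_div]
  set y : ι → ℝ := fun i => x i - 𝔼 j, x j with hy
  have hn : (Fintype.card ι : ℝ) ≠ 0 := Nat.cast_ne_zero.mpr Fintype.card_ne_zero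
  have hsum : ∑ i, y i = 0 := by
    simp only [hy, Finset.sum_sub_distrib, Finset.sum_const, Finset.card_univ,
      Fintype.card_smul_expect, sub_self]
  have hpair : ∀ i j, (x i - x j) ^ 2 / 2 = y i ^ 2 / 2 + y j ^ 2 / 2 - y i * y j := fun i j => by
    simp only [hy]
    ring
  have hdouble : ∑ i, ∑ j, (x i - x j) ^ 2 / 2 = Fintype.card ι * ∑ i, y i ^ 2 := by
    simp only [hpair, Finset.sum_add_distrib, Finset.sum_sub_distrib, ← Finset.mul_sum, hsum,
      mul_zero, Finset.sum_const, Finset.card_univ, nsmul_eq_mul, ← Finset.sum_div]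
    ring
  rw [pairAverage_eq_sum_div, hdouble]
  simp only [sub_self, ne_eq, OfNat.ofNat_ne_zero, not_false_eq_true, zero_pow, zero_div,
    Finset.sum_const_zero, sub_zero]
  rw [mul_div_mul_left _ _ hn, sampleVar]

theorem pairAverage_add_div_two (v : ι → ℝ) (hn : 2 ≤ Fintype.card ι) :
    pairAverage (fun i j => (v i + v j) / 2) = 𝔼 i, v i := by
  have hn' : (2 : ℝ) ≤ Fintype.card ι := by exact_mod_cast hn
  have hn1 : (Fintype.card ι : ℝ) - 1 ≠ 0 := by linarith
  rw [pairAverage_eq_sum_div, Fintype.expect_eq_sum_div_card]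
  simp only [add_div, Finset.sum_add_distrib, Finset.sum_const, Finset.card_univ, nsmul_eq_mul,
    ← Finset.mul_sum, ← Finset.sum_div]
  field_simp
  ring

theorem sampleVar_nonneg (x : ι → ℝ) : 0 ≤ sampleVar x := by
  rw [sampleVar_eq_pairAverage]
  exact Finset.expect_nonneg fun p _ => by positivity

theorem sampleVar_le {x : ι → ℝ} {R : ℝ} (hn : 2 ≤ Fintype.card ι)
    (hx : ∀ i j, |x i - x j| ≤ R) : sampleVar x ≤ R ^ 2 / 2 := by
  rw [sampleVar_eq_pairAverage]
  refine (pairAverage_mem_Icc (a := 0) hn fun i j _ => ⟨by positivity, ?_⟩).2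
  rw [← sq_abs]
  gcongr
  exact hx i j

variable {Ω : Type*} [MeasurableSpace Ω] {P : Measure Ω} [IsProbabilityMeasure P] {X : ι → Ω → ℝ}

theorem integral_sq_sub_div_two {Y Z : Ω → ℝ} (hY : MemLp Y 2 P) (hZ : MemLp Z 2 P)
    (hind : IndepFun Y Z P) :
    ∫ ω, (Y ω - Z ω) ^ 2 / 2 ∂P = (Var[Y; P] + Var[Z; P]) / 2 + (P[Y] - P[Z]) ^ 2 / 2 := by
  have hvar : Var[Y - Z; P] = ∫ ω, (Y ω - Z ω) ^ 2 ∂P - (P[Y] - P[Z]) ^ 2 := by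
    rw [variance_eq_sub (hY.sub hZ), ← integral_sub (hY.integrable one_le_two)
      (hZ.integrable one_le_two)]
    rfl
  have hadd : Var[Y - Z; P] = Var[Y; P] + Var[Z; P] := by
    rw [variance_sub hY hZ, hind.covariance_eq_zero hY hZ]
    ring
  rw [integral_div]
  linarith

theorem integral_sampleVar (hX : ∀ i, MemLp (X i) 2 P)
    (hind : Pairwise fun i j => IndepFun (X i) (X j) P) (hn : 2 ≤ Fintype.card ι) :
    ∫ ω, sampleVar (fun i => X i ω) ∂P = 𝔼 i, Var[X i; P] + sampleVar fun i => P[X i] := by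
  simp only [sampleVar_eq_pairAverage]
  rw [integral_pairAverage (g := fun i j ω => (X i ω - X j ω) ^ 2 / 2)
      fun i j _ => ((hX i).sub (hX j)).integrable_sq.div_const 2,
    ← pairAverage_add_div_two _ hn, pairAverage, pairAverage, pairAverage,
    ← Finset.expect_add_distrib]
  exact Finset.expect_congr rfl fun p hp =>
    integral_sq_sub_div_two (hX _) (hX _) (hind (Finset.mem_offDiag.mp hp).2.2)

theorem sqrt_integral_sampleVar_le (hX : ∀ i, MemLp (X i) 2 P)
    (hind : Pairwise fun i j => IndepFun (X i) (X j) P) (hn : 2 ≤ Fintype.card ι) {c D : ℝ}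
    (hD : ∀ i, |P[X i] - c| ≤ D) :
    √(∫ ω, sampleVar (fun i => X i ω) ∂P) ≤ √(𝔼 i, Var[X i; P]) + √2 * D := by
  obtain ⟨i₀⟩ : Nonempty ι := Fintype.card_pos_iff.mp (by omega)
  have hD0 : 0 ≤ D := (abs_nonneg _).trans (hD i₀)
  have hvar0 : 0 ≤ 𝔼 i, Var[X i; P] := Finset.expect_nonneg fun i _ => variance_nonneg _ _
  have hbias : sampleVar (fun i => P[X i]) ≤ 2 * D ^ 2 := by
    refine (sampleVar_le (R := 2 * D) hn fun i j => ?_).trans_eq (by ring)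
    linarith [abs_sub_le (P[X i]) c (P[X j]), hD i, hD j, abs_sub_comm c (P[X j])]
  calc √(∫ ω, sampleVar (fun i => X i ω) ∂P)
      ≤ √(𝔼 i, Var[X i; P] + 2 * D ^ 2) := by
        rw [integral_sampleVar hX hind hn]
        gcongr
    _ ≤ √(𝔼 i, Var[X i; P]) + √(2 * D ^ 2) := by
        rw [Real.sqrt_le_left (by positivity), add_sq, Real.sq_sqrt hvar0,
          Real.sq_sqrt (by positivity)]
        linarith [mul_nonneg (Real.sqrt_nonneg (𝔼 i, Var[X i; P])) (Real.sqrt_nonneg (2 * D ^ 2))]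
    _ = √(𝔼 i, Var[X i; P]) + √2 * D := by
        rw [Real.sqrt_mul zero_le_two, Real.sqrt_sq hD0]

variable {a b : ℝ}

theorem measure_abs_sqrt_sampleVar_sub_gt_le (hX : ∀ i, AEMeasurable (X i) P)
    (hXab : ∀ i, ∀ᵐ ω ∂P, X i ω ∈ Set.Icc a b) (hind : iIndepFun X P) (hab : a ≤ b)
    (hn : 2 ≤ Fintype.card ι) {L : ℝ} (hL : 0 ≤ L) :
    P.real {ω | (b - a) * √(L / ((Fintype.card ι : ℝ) - 1)) <
      |√(sampleVar fun i => X i ω) - √(∫ ω', sampleVar (fun i => X i ω') ∂P)|} ≤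
      2 * Real.exp (-L) := by
  have hM : 0 ≤ b - a := sub_nonneg.mpr hab
  have hkernel : ∀ i j, i ≠ j →
      ∀ᵐ ω ∂P, (X i ω - X j ω) ^ 2 / 2 ∈ Set.Icc 0 ((b - a) ^ 2 / 2) := fun i j _ => by
    filter_upwards [hXab i, hXab j] with ω hi hj
    exact ⟨by positivity, div_le_div_of_nonneg_right
      (sq_le_sq' (by linarith [hi.1, hj.2]) (by linarith [hi.2, hj.1])) zero_le_two⟩
  have hm0 : 0 < Fintype.card ι / 2 := by omega
  have hn' : (2 : ℝ) ≤ Fintype.card ι := by exact_mod_cast hn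
  have hn1 : (0 : ℝ) < Fintype.card ι - 1 := by linarith
  have hhalf : (Fintype.card ι : ℝ) - 1 ≤ 2 * (Fintype.card ι / 2 : ℕ) := by
    rw [sub_le_iff_le_add]
    exact_mod_cast (by omega : Fintype.card ι ≤ 2 * (Fintype.card ι / 2) + 1)
  have hrate : √((b - a) ^ 2 / 2 * L / (Fintype.card ι / 2 : ℕ)) ≤
      (b - a) * √(L / ((Fintype.card ι : ℝ) - 1)) := by
    rw [← Real.sqrt_sq hM, ← Real.sqrt_mul (sq_nonneg _), Real.sqrt_sq hM]
    refine Real.sqrt_le_sqrt ?_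
    calc (b - a) ^ 2 / 2 * L / (Fintype.card ι / 2 : ℕ)
        = (b - a) ^ 2 * (L / (2 * (Fintype.card ι / 2 : ℕ))) := by field_simp
      _ ≤ (b - a) ^ 2 * (L / ((Fintype.card ι : ℝ) - 1)) := by gcongr
  simp only [sampleVar_eq_pairAverage]
  refine (measureReal_mono (Set.ofPred_subset_ofPred.mpr fun ω hω => hrate.trans_lt hω)).trans ?_
  exact measure_abs_sqrt_pairAverage_sub_gt_le (f := fun x y => (x - y) ^ 2 / 2) hX hind
    (((measurable_fst.sub measurable_snd).pow_const 2).div_const 2) hkernel hm0 (by omega) hL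

end SampleVariance

section EmpiricalBernstein

open scoped BigOperators

variable {Ω ι : Type*} [MeasurableSpace Ω] [Fintype ι] {P : Measure Ω} [IsProbabilityMeasure P]
  {X : ι → Ω → ℝ} {a b : ℝ}

theorem measure_abs_expect_sub_gt_le [Nonempty ι] (hX : ∀ i, AEMeasurable (X i) P)
    (hXab : ∀ i, ∀ᵐ ω ∂P, X i ω ∈ Set.Icc a b) (hind : iIndepFun X P) (hab : a ≤ b)
    {L : ℝ} (hL : 0 ≤ L) :
    P.real {ω | √(𝔼 i, Var[X i; P]) * √(2 * L / Fintype.card ι) +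
      (b - a) * L / (2 * Fintype.card ι) < |𝔼 i, X i ω - 𝔼 i, P[X i]|} ≤ 2 * Real.exp (-L) := by
  have hn : (0 : ℝ) < Fintype.card ι := Nat.cast_pos.mpr Fintype.card_pos
  have hvar : 0 ≤ 𝔼 i, Var[X i; P] := Finset.expect_nonneg fun i _ => variance_nonneg _ _
  have hradius : √(2 * (∑ i, Var[X i; P]) * L) + (b - a) / 2 * L =
      Fintype.card ι * (√(𝔼 i, Var[X i; P]) * √(2 * L / Fintype.card ι) +
        (b - a) * L / (2 * Fintype.card ι)) := by
    rw [← Real.sqrt_mul hvar, ← Fintype.card_mul_expect, mul_add]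
    congr 1
    · rw [← Real.sqrt_sq hn.le, ← Real.sqrt_mul (sq_nonneg _), Real.sqrt_sq hn.le]
      congr 1
      field_simp
    · field_simp
  refine le_of_eq_of_le (congrArg P.real (Set.ext fun ω => ?_))
    (measure_abs_sum_sub_integral_gt_le hX hXab hind hab hL)
  rw [Set.mem_ofPred_eq, Set.mem_ofPred_eq, hradius, Finset.sum_sub_distrib,
    ← Fintype.card_mul_expect, ← Fintype.card_mul_expect, ← mul_sub, abs_mul,
    abs_of_pos hn, mul_lt_mul_iff_right₀ hn]

theorem bernstein_radius_le {n M L s w : ℝ} (hn : 2 ≤ n) (hM : 0 ≤ M) (hL : 0 ≤ L)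
    (hs : s ≤ w + M * √(L / (n - 1))) :
    s * √(2 * L / n) + M * L / (2 * n) ≤ w * √(2 * L / n) + 8 * M * L / (3 * (n - 1)) := by
  have hn1 : 0 < n - 1 := by linarith
  have hroot : √(2 * L / n) ≤ 2 * √(L / (n - 1)) := by
    rw [Real.sqrt_le_left (by positivity), mul_pow, Real.sq_sqrt (by positivity)]
    calc 2 * L / n ≤ 2 * L / (n - 1) := by gcongr; linarith
      _ ≤ 2 ^ 2 * (L / (n - 1)) := by
        rw [← mul_div_assoc]
        gcongr
        norm_num
  calc s * √(2 * L / n) + M * L / (2 * n)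
      ≤ (w + M * √(L / (n - 1))) * √(2 * L / n) + M * L / (n - 1) / 2 := by
        rw [div_div, mul_comm (n - 1)]
        gcongr
        linarith
    _ = w * √(2 * L / n) + M * √(L / (n - 1)) * √(2 * L / n) + M * L / (n - 1) / 2 := by
        rw [add_mul]
    _ ≤ w * √(2 * L / n) + M * √(L / (n - 1)) * (2 * √(L / (n - 1))) +
        M * L / (n - 1) / 2 := by gcongr
    _ = w * √(2 * L / n) + 5 / 2 * (M * L / (n - 1)) := by
        rw [mul_div_assoc M]
        linear_combination 2 * M * Real.mul_self_sqrt (by positivity : 0 ≤ L / (n - 1))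
    _ ≤ w * √(2 * L / n) + 8 / 3 * (M * L / (n - 1)) := by
        linarith [(by positivity : 0 ≤ M * L / (n - 1))]
    _ = w * √(2 * L / n) + 8 * M * L / (3 * (n - 1)) := by field_simp

-- An empirical Bernstein bound that does not require identical distributions: the spread `D` of
-- the means only enters the comparison of the sample variance with the average variance.
theorem measure_empirical_bernstein_compl_le (hX : ∀ i, AEMeasurable (X i) P)
    (hXab : ∀ i, ∀ᵐ ω ∂P, X i ω ∈ Set.Icc a b) (hind : iIndepFun X P) (hab : a ≤ b)
    (hn : 2 ≤ Fintype.card ι) {L : ℝ} (hL : 0 ≤ L) {c D : ℝ} (hD : ∀ i, |P[X i] - c| ≤ D) :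
    P.real {ω | ¬ (|𝔼 i, X i ω - 𝔼 i, P[X i]| ≤
          √(sampleVar fun i => X i ω) * √(2 * L / Fintype.card ι) +
            8 * (b - a) * L / (3 * ((Fintype.card ι : ℝ) - 1)) ∧
        √(sampleVar fun i => X i ω) ≤ √(𝔼 i, Var[X i; P]) + √2 * D +
          (b - a) * √(L / ((Fintype.card ι : ℝ) - 1)))} ≤ 4 * Real.exp (-L) := by
  have : Nonempty ι := Fintype.card_pos_iff.mp (by omega)
  have hL2 : ∀ i, MemLp (X i) 2 P := fun i =>
    memLp_of_bounded (hXab i) (hX i).aestronglyMeasurable 2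
  have hpair : Pairwise fun i j => IndepFun (X i) (X j) P := fun i j hij => hind.indepFun hij
  have hvar_le : √(𝔼 i, Var[X i; P]) ≤ √(∫ ω, sampleVar (fun i => X i ω) ∂P) := by
    rw [integral_sampleVar hL2 hpair hn]
    exact Real.sqrt_le_sqrt (le_add_of_nonneg_right (sampleVar_nonneg _))
  have hle_var := sqrt_integral_sampleVar_le hL2 hpair hn hD
  rw [show 4 * Real.exp (-L) = 2 * Real.exp (-L) + 2 * Real.exp (-L) by ring]
  refine (measureReal_mono (fun ω hω => ?_)).trans ((measureReal_union_le _ _).trans (add_le_add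
    (measure_abs_expect_sub_gt_le hX hXab hind hab hL)
    (measure_abs_sqrt_sampleVar_sub_gt_le hX hXab hind hab hn hL)))
  by_contra hnot
  simp only [Set.mem_union, Set.mem_ofPred_eq, not_or, not_lt] at hnot
  obtain ⟨hmean, hdev⟩ := hnot
  rw [abs_le] at hdev
  refine hω ⟨hmean.trans
    (bernstein_radius_le (by exact_mod_cast hn) (sub_nonneg.mpr hab) hL ?_), ?_⟩
  · linarith
  · linarith

end EmpiricalBernstein

section Window

open scoped BigOperators

variable {B : ℕ → ℕ} {t k : ℕ} {Q : ℕ → Measure ℝ}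

/-- The pairs `⟨j, i⟩` that index the samples in the look-back window of length `k`. -/
def windowIndex (B : ℕ → ℕ) (t k : ℕ) : Finset (Σ _ : ℕ, ℕ) :=
  (window t k).sigma fun j => Finset.Icc 1 (B j)

/-- The population counterpart of `empMean`: the average, over the samples in the window, of the
mean of their distribution. -/
noncomputable def windowMean (Q : ℕ → Measure ℝ) (B : ℕ → ℕ) (t k : ℕ) : ℝ :=
  𝔼 p : windowIndex B t k, popMean Q p.1.1

theorem sum_windowIndex (f : ℕ → ℕ → ℝ) :
    ∑ p : windowIndex B t k, f p.1.1 p.1.2 =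
      ∑ j ∈ window t k, ∑ i ∈ Finset.Icc 1 (B j), f j i := by
  rw [Finset.sum_coe_sort (windowIndex B t k) (fun p => f p.1 p.2), windowIndex, Finset.sum_sigma]

theorem card_windowIndex : Fintype.card (windowIndex B t k) = windowSize B t k := by
  rw [Fintype.card_coe, windowIndex, Finset.card_sigma, windowSize]
  simp only [Nat.card_Icc, Nat.add_sub_cancel]

theorem empMean_eq_expect (x : ℕ → ℕ → ℝ) :
    empMean B x t k = 𝔼 p : windowIndex B t k, x p.1.1 p.1.2 := by
  rw [Fintype.expect_eq_sum_div_card, sum_windowIndex, card_windowIndex, empMean, inv_mul_eq_div]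

theorem empStd_eq_sqrt_sampleVar (x : ℕ → ℕ → ℝ) :
    empStd B x t k = √(sampleVar fun p : windowIndex B t k => x p.1.1 p.1.2) := by
  rw [sampleVar, ← empMean_eq_expect, sum_windowIndex fun j i => (x j i - empMean B x t k) ^ 2,
    card_windowIndex, empStd, inv_mul_eq_div]

theorem popStd_eq_sqrt_expect :
    popStd Q B t k = √(𝔼 p : windowIndex B t k, Var[fun x : ℝ => x; Q p.1.1]) := by
  rw [Fintype.expect_eq_sum_div_card, sum_windowIndex fun j _ => Var[fun x : ℝ => x; Q j],
    card_windowIndex, popStd, inv_mul_eq_div]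
  simp only [Finset.sum_const, Nat.card_Icc, Nat.add_sub_cancel, nsmul_eq_mul]

theorem window_subset : window t k ⊆ Finset.Icc 1 t :=
  Finset.Icc_subset_Icc_left (by omega)

theorem window_mono {i : ℕ} (hik : i ≤ k) : window t i ⊆ window t k :=
  Finset.Icc_subset_Icc_left (by omega)

theorem self_mem_window (hk : k ∈ Finset.Icc 1 t) : t ∈ window t k := by
  simp only [window, Finset.mem_Icc] at hk ⊢
  omega

theorem windowIndex_subset : windowIndex B t k ⊆ sampleIndex B t :=
  Finset.sigma_mono window_subset fun _ => subset_rfl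

theorem windowSize_pos (hB : ∀ j ∈ Finset.Icc 1 t, 1 ≤ B j) (hk : k ∈ Finset.Icc 1 t) :
    0 < windowSize B t k :=
  Finset.sum_pos (fun j hj => hB j (window_subset hj)) ⟨t, self_mem_window hk⟩

theorem nonempty_windowIndex (hB : ∀ j ∈ Finset.Icc 1 t, 1 ≤ B j) (hk : k ∈ Finset.Icc 1 t) :
    Nonempty (windowIndex B t k) := by
  rw [← Fintype.card_pos_iff, card_windowIndex]
  exact windowSize_pos hB hk

theorem popStd_le {a b : ℝ} (hab : a ≤ b) (hB : ∀ j ∈ Finset.Icc 1 t, 1 ≤ B j)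
    (hp : ∀ j ∈ Finset.Icc 1 t, IsProbabilityMeasure (Q j))
    (hQ : ∀ j ∈ Finset.Icc 1 t, ∀ᵐ x ∂(Q j), x ∈ Set.Icc a b) (hk : k ∈ Finset.Icc 1 t) :
    popStd Q B t k ≤ b - a := by
  have := nonempty_windowIndex hB hk
  rw [popStd_eq_sqrt_expect, Real.sqrt_le_left (sub_nonneg.mpr hab)]
  refine Finset.expect_le Finset.univ_nonempty fun p _ => ?_
  have hj := window_subset (Finset.mem_sigma.mp p.2).1
  have := hp _ hj
  refine (variance_le_sq_of_bounded (hQ _ hj) aemeasurable_id').trans ?_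
  gcongr
  linarith

theorem abs_popMean_sub_le_phi {j : ℕ} (hj : j ∈ window t k) :
    |popMean Q j - popMean Q t| ≤ phi Q t k :=
  le_ciSup (f := fun j : window t k => |popMean Q j - popMean Q t|)
    (Set.finite_range _).bddAbove ⟨j, hj⟩

theorem phi_nonneg : 0 ≤ phi Q t k :=
  Real.iSup_nonneg fun _ => abs_nonneg _

theorem abs_windowMean_sub_le_phi (hB : ∀ j ∈ Finset.Icc 1 t, 1 ≤ B j) {i : ℕ}
    (hi : i ∈ Finset.Icc 1 t) (hik : i ≤ k) :
    |windowMean Q B t i - popMean Q t| ≤ phi Q t k := by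
  have := nonempty_windowIndex hB hi
  rw [windowMean, ← Fintype.expect_const (ι := windowIndex B t i) (popMean Q t),
    ← Finset.expect_sub_distrib]
  exact (Finset.abs_expect_le _ _).trans (Finset.expect_le Finset.univ_nonempty fun p _ =>
    abs_popMean_sub_le_phi (window_mono hik (Finset.mem_sigma.mp p.2).1))

end Window

section Selection

variable {B : ℕ → ℕ} {x : ℕ → ℕ → ℝ} {M δ' : ℝ} {t k : ℕ} {Q : ℕ → Measure ℝ}

theorem phiHat_nonneg : 0 ≤ phiHat B x M t k δ' :=
  Real.iSup_nonneg fun _ => le_max_right _ _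

theorem abs_empMean_sub_le_phiHat_add {i : ℕ} (hi : i ∈ Finset.Icc 1 k) :
    |empMean B x t k - empMean B x t i| ≤
      phiHat B x M t k δ' + (psiHat B x M t k δ' + psiHat B x M t i δ') := by
  rw [← sub_le_iff_le_add]
  exact (le_max_left _ _).trans (le_ciSup (f := fun i : Finset.Icc 1 k =>
    max (|empMean B x t k - empMean B x t i| - (psiHat B x M t k δ' + psiHat B x M t i δ')) 0)
    (Set.finite_range _).bddAbove ⟨i, hi⟩)

theorem abs_empMean_sub_empMean_le {k' : ℕ} (hk : 1 ≤ k) (hk' : 1 ≤ k') :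
    |empMean B x t k' - empMean B x t k| ≤
      (phiHat B x M t k δ' + psiHat B x M t k δ') +
        (phiHat B x M t k' δ' + psiHat B x M t k' δ') := by
  have hφ : 0 ≤ phiHat B x M t k δ' := phiHat_nonneg
  have hφ' : 0 ≤ phiHat B x M t k' δ' := phiHat_nonneg
  rcases le_total k k' with h | h
  · linarith [abs_empMean_sub_le_phiHat_add (B := B) (x := x) (M := M) (δ' := δ') (t := t)
      (Finset.mem_Icc.mpr ⟨hk, h⟩)]
  · rw [abs_sub_comm]
    linarith [abs_empMean_sub_le_phiHat_add (B := B) (x := x) (M := M) (δ' := δ') (t := t)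
      (Finset.mem_Icc.mpr ⟨hk', h⟩)]

theorem phiHat_le_two_mul_phi (hB : ∀ j ∈ Finset.Icc 1 t, 1 ≤ B j)
    (hψ : ∀ k ∈ Finset.Icc 1 t, |empMean B x t k - windowMean Q B t k| ≤ psiHat B x M t k δ')
    (hk : k ∈ Finset.Icc 1 t) : phiHat B x M t k δ' ≤ 2 * phi Q t k := by
  have hφ : 0 ≤ phi Q t k := phi_nonneg
  refine Real.iSup_le (fun ⟨i, hi⟩ => max_le ?_ (by linarith)) (by linarith)
  have hit : i ∈ Finset.Icc 1 t := Finset.Icc_subset_Icc_right (Finset.mem_Icc.mp hk).2 hi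
  have hdev := abs_le.mp (hψ k hk)
  have hdev_i := abs_le.mp (hψ i hit)
  have hbias := abs_le.mp (abs_windowMean_sub_le_phi (Q := Q) hB hk le_rfl)
  have hbias_i := abs_le.mp (abs_windowMean_sub_le_phi (Q := Q) hB hit (Finset.mem_Icc.mp hi).2)
  rw [sub_le_iff_le_add, abs_le]
  constructor <;> linarith

theorem abs_empMean_selected_sub_le (hB : ∀ j ∈ Finset.Icc 1 t, 1 ≤ B j)
    (hψ : ∀ k ∈ Finset.Icc 1 t, |empMean B x t k - windowMean Q B t k| ≤ psiHat B x M t k δ')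
    {k' : ℕ} (hk' : k' ∈ selectedWindows B x M t δ') (hk : k ∈ Finset.Icc 1 t) :
    |empMean B x t k' - popMean Q t| ≤ 5 * phi Q t k + 3 * psiHat B x M t k δ' := by
  obtain ⟨hk't, hmin⟩ := hk'
  calc |empMean B x t k' - popMean Q t|
      ≤ |empMean B x t k' - empMean B x t k| + |empMean B x t k - windowMean Q B t k| +
          |windowMean Q B t k - popMean Q t| :=
        (abs_sub_le _ (windowMean Q B t k) _).trans
          (add_le_add_left (abs_sub_le _ _ _) _)
    _ ≤ 2 * (phiHat B x M t k δ' + psiHat B x M t k δ') + psiHat B x M t k δ' + phi Q t k := by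
        gcongr ?_ + ?_ + ?_
        · linarith [hmin k hk, abs_empMean_sub_empMean_le (B := B) (x := x) (M := M) (δ' := δ')
            (t := t) (Finset.mem_Icc.mp hk).1 (Finset.mem_Icc.mp hk't).1]
        · exact hψ k hk
        · exact abs_windowMean_sub_le_phi hB hk le_rfl
    _ ≤ 5 * phi Q t k + 3 * psiHat B x M t k δ' := by
        linarith [phiHat_le_two_mul_phi hB hψ hk]

end Selection

section Calibration

open scoped BigOperators

variable {Ω : Type*} [MeasurableSpace Ω] {P : Measure Ω} {a b δ' : ℝ} {t k : ℕ} {B : ℕ → ℕ}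
  {Q : ℕ → Measure ℝ} {u : ℕ → ℕ → Ω → ℝ}

/-- The data `x` are calibrated on the window of length `k` if `psiHat` is a valid confidence
radius for `empMean` there, and is itself at most a Bernstein radius with the population standard
deviation, up to the drift `phi` of the window. -/
def IsCalibrated (Q : ℕ → Measure ℝ) (B : ℕ → ℕ) (x : ℕ → ℕ → ℝ) (M : ℝ) (t k : ℕ) (δ' : ℝ) :
    Prop :=
  |empMean B x t k - windowMean Q B t k| ≤ psiHat B x M t k δ' ∧
    psiHat B x M t k δ' ≤ popStd Q B t k * √(2 * Real.log (2 / δ') / windowSize B t k) +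
      √2 * √(Real.log (2 / δ')) * phi Q t k + 10 * M * Real.log (2 / δ') / windowSize B t k

theorem hasLaw_windowIndex
    (hu : ∀ j ∈ Finset.Icc 1 t, ∀ i ∈ Finset.Icc 1 (B j), HasLaw (u j i) (Q j) P)
    (p : windowIndex B t k) : HasLaw (u p.1.1 p.1.2) (Q p.1.1) P :=
  have hp := Finset.mem_sigma.mp (windowIndex_subset p.2)
  hu _ hp.1 _ hp.2

theorem ae_mem_Icc_windowIndex (hQ : ∀ j ∈ Finset.Icc 1 t, ∀ᵐ x ∂(Q j), x ∈ Set.Icc a b)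
    (hu : ∀ j ∈ Finset.Icc 1 t, ∀ i ∈ Finset.Icc 1 (B j), HasLaw (u j i) (Q j) P)
    (p : windowIndex B t k) : ∀ᵐ ω ∂P, u p.1.1 p.1.2 ω ∈ Set.Icc a b := by
  have hlaw := hasLaw_windowIndex hu p
  refine ae_of_ae_map hlaw.aemeasurable ?_
  rw [hlaw.map_eq]
  exact hQ _ (window_subset (Finset.mem_sigma.mp p.2).1)

theorem iIndepFun_windowIndex
    (hind : iIndepFun (fun p : sampleIndex B t => u p.1.1 p.1.2) P) :
    iIndepFun (fun p : windowIndex B t k => u p.1.1 p.1.2) P :=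
  hind.precomp (g := Set.inclusion windowIndex_subset) (Set.inclusion_injective _)

theorem windowMean_eq_expect_integral
    (hu : ∀ j ∈ Finset.Icc 1 t, ∀ i ∈ Finset.Icc 1 (B j), HasLaw (u j i) (Q j) P) :
    windowMean Q B t k = 𝔼 p : windowIndex B t k, P[u p.1.1 p.1.2] :=
  Finset.expect_congr rfl fun p _ => (hasLaw_windowIndex hu p).integral_eq.symm

theorem popStd_eq_sqrt_expect_variance
    (hu : ∀ j ∈ Finset.Icc 1 t, ∀ i ∈ Finset.Icc 1 (B j), HasLaw (u j i) (Q j) P) :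
    popStd Q B t k = √(𝔼 p : windowIndex B t k, Var[u p.1.1 p.1.2; P]) := by
  rw [popStd_eq_sqrt_expect]
  exact congrArg Real.sqrt
    (Finset.expect_congr rfl fun p _ => (hasLaw_windowIndex hu p).variance_eq.symm)

theorem empirical_radius_le {s v D M L n : ℝ} (hn : 2 ≤ n) (hD : 0 ≤ D) (hM : 0 ≤ M) (hL : 0 ≤ L)
    (hv : v ≤ s + √2 * D + M * √(L / (n - 1))) :
    v * √(2 * L / n) + 8 * M * L / (3 * (n - 1)) ≤
      s * √(2 * L / n) + √2 * √L * D + 10 * M * L / n := by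
  have hn1 : 0 < n - 1 := by linarith
  have hn0 : 0 < n := by linarith
  have hroot : √(2 * L / n) ≤ √L := by
    refine Real.sqrt_le_sqrt ?_
    rw [div_le_iff₀ hn0, mul_comm]
    gcongr
  have hratio : L / (n - 1) ≤ 2 * (L / n) := by
    rw [← mul_div_assoc, div_le_div_iff₀ hn1 hn0]
    linarith [mul_le_mul_of_nonneg_left (by linarith : n ≤ 2 * (n - 1)) hL]
  have hprod : √(L / (n - 1)) * √(2 * L / n) ≤ 2 * (L / n) := by
    rw [← mul_div_assoc] at hratio ⊢
    calc √(L / (n - 1)) * √(2 * L / n) ≤ √(2 * L / n) * √(2 * L / n) := by gcongr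
      _ = 2 * L / n := Real.mul_self_sqrt (by positivity)
  have hlast : 8 * M * L / (3 * (n - 1)) ≤ 8 * (M * (L / n)) := by
    have hMratio := mul_le_mul_of_nonneg_left hratio hM
    have hMn : 0 ≤ M * (L / n) := by positivity
    calc 8 * M * L / (3 * (n - 1)) = 8 / 3 * (M * (L / (n - 1))) := by field_simp
      _ ≤ 8 * (M * (L / n)) := by linarith
  calc v * √(2 * L / n) + 8 * M * L / (3 * (n - 1))
      ≤ (s + √2 * D + M * √(L / (n - 1))) * √(2 * L / n) + 8 * (M * (L / n)) := by gcongr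
    _ = s * √(2 * L / n) + √2 * √(2 * L / n) * D + M * (√(L / (n - 1)) * √(2 * L / n)) +
          8 * (M * (L / n)) := by ring
    _ ≤ s * √(2 * L / n) + √2 * √L * D + M * (2 * (L / n)) + 8 * (M * (L / n)) := by gcongr
    _ = s * √(2 * L / n) + √2 * √L * D + 10 * M * L / n := by ring

variable [IsProbabilityMeasure P]

theorem ae_isCalibrated_of_windowSize_eq_one (hsize : windowSize B t k = 1) (hab : a ≤ b)
    (hQ : ∀ j ∈ Finset.Icc 1 t, ∀ᵐ x ∂(Q j), x ∈ Set.Icc a b)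
    (hu : ∀ j ∈ Finset.Icc 1 t, ∀ i ∈ Finset.Icc 1 (B j), HasLaw (u j i) (Q j) P)
    (hL : 1 ≤ Real.log (2 / δ')) :
    ∀ᵐ ω ∂P, IsCalibrated Q B (fun j i => u j i ω) (b - a) t k δ' := by
  obtain ⟨p, hp⟩ := Fintype.card_eq_one_iff.mp (card_windowIndex.trans hsize)
  have huniv : Finset.univ = {p} :=
    Finset.eq_singleton_iff_unique_mem.mpr ⟨Finset.mem_univ p, fun q _ => hp q⟩
  have hbox := ae_mem_Icc_windowIndex hQ hu p
  have hmean := integral_mem_Icc (hasLaw_windowIndex hu p).aemeasurable hbox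
  filter_upwards [hbox] with ω hω
  rw [IsCalibrated, psiHat, if_pos hsize, hsize, Nat.cast_one, div_one, div_one,
    empMean_eq_expect, windowMean_eq_expect_integral hu, huniv,
    Finset.expect_singleton, Finset.expect_singleton]
  have hφ : 0 ≤ phi Q t k := phi_nonneg
  have hσ : 0 ≤ popStd Q B t k := Real.sqrt_nonneg _
  have hM := mul_le_mul_of_nonneg_left hL (sub_nonneg.mpr hab)
  constructor
  · rw [abs_le]
    constructor <;> linarith [hω.1, hω.2, hmean.1, hmean.2]
  · refine le_trans ?_ (le_add_of_nonneg_left (by positivity))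
    linarith

theorem measure_not_isCalibrated_le_of_two_le_windowSize (hsize : 2 ≤ windowSize B t k)
    (hab : a ≤ b) (hQ : ∀ j ∈ Finset.Icc 1 t, ∀ᵐ x ∂(Q j), x ∈ Set.Icc a b)
    (hu : ∀ j ∈ Finset.Icc 1 t, ∀ i ∈ Finset.Icc 1 (B j), HasLaw (u j i) (Q j) P)
    (hind : iIndepFun (fun p : sampleIndex B t => u p.1.1 p.1.2) P)
    (hL : 0 ≤ Real.log (2 / δ')) :
    P.real {ω | ¬ IsCalibrated Q B (fun j i => u j i ω) (b - a) t k δ'} ≤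
      4 * Real.exp (-Real.log (2 / δ')) := by
  have hD : ∀ p : windowIndex B t k, |P[u p.1.1 p.1.2] - popMean Q t| ≤ phi Q t k := fun p => by
    rw [(hasLaw_windowIndex hu p).integral_eq]
    exact abs_popMean_sub_le_phi (Finset.mem_sigma.mp p.2).1
  have hconc := measure_empirical_bernstein_compl_le
    (fun p => (hasLaw_windowIndex hu p).aemeasurable) (ae_mem_Icc_windowIndex hQ hu)
    (iIndepFun_windowIndex hind) hab (by rwa [card_windowIndex]) hL hD
  refine (measureReal_mono (Set.ofPred_subset_ofPred.mpr fun ω => mt fun hω => ?_)).trans hconc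
  simp only [← empMean_eq_expect fun j i => u j i ω, ← windowMean_eq_expect_integral hu,
    ← popStd_eq_sqrt_expect_variance hu, ← empStd_eq_sqrt_sampleVar fun j i => u j i ω,
    card_windowIndex] at hω
  rw [IsCalibrated, psiHat, if_neg (by omega)]
  exact ⟨hω.1, empirical_radius_le (by exact_mod_cast hsize) phi_nonneg (sub_nonneg.mpr hab) hL
    hω.2⟩

theorem measure_not_isCalibrated_le (hB : ∀ j ∈ Finset.Icc 1 t, 1 ≤ B j) (hab : a ≤ b)
    (hQ : ∀ j ∈ Finset.Icc 1 t, ∀ᵐ x ∂(Q j), x ∈ Set.Icc a b)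
    (hu : ∀ j ∈ Finset.Icc 1 t, ∀ i ∈ Finset.Icc 1 (B j), HasLaw (u j i) (Q j) P)
    (hind : iIndepFun (fun p : sampleIndex B t => u p.1.1 p.1.2) P)
    (hL : 1 ≤ Real.log (2 / δ')) (hk : k ∈ Finset.Icc 1 t) :
    P.real {ω | ¬ IsCalibrated Q B (fun j i => u j i ω) (b - a) t k δ'} ≤
      4 * Real.exp (-Real.log (2 / δ')) := by
  rcases (Nat.succ_le_of_lt (windowSize_pos hB hk)).eq_or_lt with hsize | hsize
  · rw [measureReal_def, ae_iff.mp (ae_isCalibrated_of_windowSize_eq_one hsize.symm hab hQ hu hL),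
      ENNReal.toReal_zero]
    positivity
  · exact measure_not_isCalibrated_le_of_two_le_windowSize hsize hab hQ hu hind (by linarith)

end Calibration

section Oracle

variable {Ω : Type*} [MeasurableSpace Ω] {P : Measure Ω} {a b δ : ℝ} {t k : ℕ} {B : ℕ → ℕ}
  {Q : ℕ → Measure ℝ} {u : ℕ → ℕ → Ω → ℝ}

theorem five_quarters_le_log_six_mul_div (ht : 1 ≤ t) (hδ : δ ∈ Set.Ioo (0 : ℝ) 1) :
    5 / 4 ≤ Real.log (6 * t / δ) := by
  have ht' : (1 : ℝ) ≤ t := by exact_mod_cast ht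
  have hlog_four : Real.log 4 = 2 * Real.log 2 := by
    rw [show (4 : ℝ) = 2 ^ 2 by norm_num, Real.log_pow, Nat.cast_two]
  have hfour : 4 ≤ 6 * t / δ := by
    rw [le_div_iff₀ hδ.1]
    linarith [hδ.2]
  linarith [Real.log_le_log four_pos hfour, Real.log_two_gt_d9]

theorem half_le_log_two_div (hδ : δ ∈ Set.Ioo (0 : ℝ) 1) : 1 / 2 ≤ Real.log (2 / δ) := by
  have htwo : 2 ≤ 2 / δ := by
    rw [le_div_iff₀ hδ.1]
    linarith [hδ.2]
  linarith [Real.log_le_log two_pos htwo, Real.log_two_gt_d9]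

theorem two_div_div_three_mul (t : ℕ) (δ : ℝ) : 2 / (δ / (3 * t)) = 6 * t / δ := by
  rw [div_div_eq_mul_div]
  ring

/-- The term for the window of length `k` in the refined oracle bound, where `L` is the logarithmic
confidence factor. -/
noncomputable def oracleTerm (Q : ℕ → Measure ℝ) (B : ℕ → ℕ) (M : ℝ) (t k : ℕ) (L : ℝ) : ℝ :=
  3 * √L * phi Q t k + popStd Q B t k * √(2 * L / windowSize B t k) +
    10 * M * L / windowSize B t k

theorem abs_empMean_selected_sub_le_oracleTerm {x : ℕ → ℕ → ℝ} {M δ' : ℝ}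
    (hB : ∀ j ∈ Finset.Icc 1 t, 1 ≤ B j) (hL : 5 / 4 ≤ Real.log (2 / δ'))
    (hcal : ∀ k ∈ Finset.Icc 1 t, IsCalibrated Q B x M t k δ') {k' : ℕ}
    (hk' : k' ∈ selectedWindows B x M t δ') (hk : k ∈ Finset.Icc 1 t) :
    |empMean B x t k' - popMean Q t| ≤ 3 * oracleTerm Q B M t k (Real.log (2 / δ')) := by
  set L := Real.log (2 / δ')
  have hsel := abs_empMean_selected_sub_le hB (fun k hk => (hcal k hk).1) hk' hk
  have hψ := (hcal k hk).2
  have hrootL : 10 / 9 ≤ √L := by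
    rw [Real.le_sqrt' (by norm_num)]
    linarith
  have hroot2 : √2 ≤ 3 / 2 := by
    rw [Real.sqrt_le_left (by norm_num)]
    norm_num
  have hcoef : 5 + 3 * (√2 * √L) ≤ 9 * √L := by
    linarith [mul_le_mul_of_nonneg_right hroot2 (Real.sqrt_nonneg L)]
  have hdrift := mul_le_mul_of_nonneg_right hcoef (phi_nonneg (Q := Q) (t := t) (k := k))
  rw [oracleTerm]
  linarith

theorem one_sub_le_measure_isCalibrated [IsProbabilityMeasure P] (ht : 1 ≤ t)
    (hB : ∀ j ∈ Finset.Icc 1 t, 1 ≤ B j) (hab : a ≤ b)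
    (hQ : ∀ j ∈ Finset.Icc 1 t, ∀ᵐ x ∂(Q j), x ∈ Set.Icc a b)
    (hu : ∀ j ∈ Finset.Icc 1 t, ∀ i ∈ Finset.Icc 1 (B j), HasLaw (u j i) (Q j) P)
    (hind : iIndepFun (fun p : sampleIndex B t => u p.1.1 p.1.2) P)
    (hδ : δ ∈ Set.Ioo (0 : ℝ) 1) :
    1 - δ ≤ P.real {ω | ∀ k ∈ Finset.Icc 1 t,
      IsCalibrated Q B (fun j i => u j i ω) (b - a) t k (δ / (3 * t))} := by
  have : (0 : ℝ) < t := by exact_mod_cast ht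
  have hδ0 : 0 < δ := hδ.1
  have hL : 1 ≤ Real.log (2 / (δ / (3 * t))) := by
    rw [two_div_div_three_mul]
    linarith [five_quarters_le_log_six_mul_div ht hδ]
  have hbad := fun k hk => measure_not_isCalibrated_le hB hab hQ hu hind hL (k := k) hk
  have hexp : Real.exp (-Real.log (2 / (δ / (3 * t)))) = δ / (6 * t) := by
    rw [two_div_div_three_mul, Real.exp_neg, Real.exp_log (by positivity), inv_div]
  set good : Set Ω := {ω | ∀ k ∈ Finset.Icc 1 t,
    IsCalibrated Q B (fun j i => u j i ω) (b - a) t k (δ / (3 * t))}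
  set bad : ℕ → Set Ω := fun k =>
    {ω | ¬ IsCalibrated Q B (fun j i => u j i ω) (b - a) t k (δ / (3 * t))}
  have hunion : P.real (⋃ k ∈ Finset.Icc 1 t, bad k) ≤ 2 / 3 * δ := by
    refine ((measureReal_biUnion_finset_le _ _).trans (Finset.sum_le_sum hbad)).trans_eq ?_
    rw [hexp, Finset.sum_const, Nat.card_Icc, Nat.add_sub_cancel, nsmul_eq_mul]
    field_simp
    norm_num
  have hcover : good ∪ ⋃ k ∈ Finset.Icc 1 t, bad k = Set.univ := by
    refine Set.eq_univ_of_forall fun ω => or_iff_not_imp_right.mpr fun hω k hk => ?_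
    by_contra hnot
    exact hω (Set.mem_biUnion (t := bad) hk hnot)
  have hone := measureReal_union_le (μ := P) good (⋃ k ∈ Finset.Icc 1 t, bad k)
  rw [hcover, probReal_univ] at hone
  linarith

theorem one_sub_le_measure_selected_le_oracleTerm [IsProbabilityMeasure P] (ht : 1 ≤ t)
    (hB : ∀ j ∈ Finset.Icc 1 t, 1 ≤ B j) (hab : a ≤ b)
    (hQ : ∀ j ∈ Finset.Icc 1 t, ∀ᵐ x ∂(Q j), x ∈ Set.Icc a b)
    (hu : ∀ j ∈ Finset.Icc 1 t, ∀ i ∈ Finset.Icc 1 (B j), HasLaw (u j i) (Q j) P)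
    (hind : iIndepFun (fun p : sampleIndex B t => u p.1.1 p.1.2) P)
    (hδ : δ ∈ Set.Ioo (0 : ℝ) 1) :
    1 - δ ≤ P.real {ω | ∀ k' ∈ selectedWindows B (fun j i => u j i ω) (b - a) t (δ / (3 * t)),
      |empMean B (fun j i => u j i ω) t k' - popMean Q t| ≤
        3 * ⨅ k : Finset.Icc 1 t, oracleTerm Q B (b - a) t k (Real.log (6 * t / δ))} := by
  have : Nonempty (Finset.Icc 1 t) := ⟨⟨t, Finset.right_mem_Icc.mpr ht⟩⟩
  have hL := five_quarters_le_log_six_mul_div ht hδ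
  rw [← two_div_div_three_mul] at hL ⊢
  refine (one_sub_le_measure_isCalibrated ht hB hab hQ hu hind hδ).trans
    (measureReal_mono (Set.ofPred_subset_ofPred.mpr fun ω hcal k' hk' => ?_))
  rw [Real.mul_iInf_of_nonneg zero_le_three]
  exact le_ciInf fun k => abs_empMean_selected_sub_le_oracleTerm hB hL hcal hk' k.2

theorem bernstein_oracleTerm_le {φ σ M L l n : ℝ} (hφ : 0 ≤ φ) (hσ : 0 ≤ σ) (hM : 0 ≤ M)
    (hn : 0 < n) (hL : 5 / 4 ≤ L) (hl : 1 / 2 ≤ l) :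
    3 * (3 * √L * φ + σ * √(2 * L / n) + 10 * M * L / n) ≤
      100 * L * (φ + (σ * √(2 * l / n) + 2 * M * l / (3 * n))) := by
  have : 0 < L := by linarith
  have hrootL : √L ≤ L := Real.sqrt_le_self_iff.mpr (Or.inr (by linarith))
  have hdev : √(2 * L / n) ≤ 2 * L * √(2 * l / n) := by
    rw [Real.sqrt_le_left (by positivity), mul_pow, Real.sq_sqrt (by positivity)]
    calc 2 * L / n = 2 * 1 * L / n := by ring
      _ ≤ 2 * (2 * l) * (2 * L * L) / n := by gcongr <;> nlinarith
      _ = (2 * L) ^ 2 * (2 * l / n) := by ring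
  have hrange : M * L / n ≤ 2 * l * (M * L / n) :=
    le_mul_of_one_le_left (by positivity) (by linarith)
  calc 3 * (3 * √L * φ + σ * √(2 * L / n) + 10 * M * L / n)
      = 9 * √L * φ + 3 * (σ * √(2 * L / n)) + 30 * (M * L / n) := by ring
    _ ≤ 9 * L * φ + 3 * (σ * (2 * L * √(2 * l / n))) + 30 * (2 * l * (M * L / n)) := by gcongr
    _ ≤ 100 * L * φ + 100 * L * (σ * √(2 * l / n)) + 200 / 3 * l * (M * L / n) := by
        have hdrift_nonneg : 0 ≤ L * φ := by positivity
        have hdev_nonneg : 0 ≤ L * (σ * √(2 * l / n)) := by positivity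
        have hrange_nonneg : 0 ≤ l * (M * L / n) := by positivity
        linarith
    _ = 100 * L * (φ + (σ * √(2 * l / n) + 2 * M * l / (3 * n))) := by ring

theorem single_sample_oracleTerm_le {φ σ M L : ℝ} (hφ : 0 ≤ φ) (hM : 0 ≤ M) (hσ : σ ≤ M)
    (hL : 1 ≤ L) : 3 * (3 * √L * φ + σ * √(2 * L) + 10 * M * L) ≤ 100 * L * (φ + M) := by
  have hL0 : 0 ≤ L := by linarith
  have hrootL : √L ≤ L := Real.sqrt_le_self_iff.mpr (Or.inr hL)
  have hroot2L : √(2 * L) ≤ 2 * L := Real.sqrt_le_self_iff.mpr (Or.inr (by linarith))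
  calc 3 * (3 * √L * φ + σ * √(2 * L) + 10 * M * L)
      ≤ 3 * (3 * L * φ + M * (2 * L) + 10 * M * L) := by gcongr
    _ ≤ 100 * L * (φ + M) := by
        linarith [mul_nonneg hL0 hφ, mul_nonneg hL0 hM]

theorem three_mul_oracleTerm_le (ht : 1 ≤ t) (hab : a ≤ b)
    (hB : ∀ j ∈ Finset.Icc 1 t, 1 ≤ B j) (hp : ∀ j ∈ Finset.Icc 1 t, IsProbabilityMeasure (Q j))
    (hQ : ∀ j ∈ Finset.Icc 1 t, ∀ᵐ x ∂(Q j), x ∈ Set.Icc a b) (hδ : δ ∈ Set.Ioo (0 : ℝ) 1)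
    (hk : k ∈ Finset.Icc 1 t) :
    3 * oracleTerm Q B (b - a) t k (Real.log (6 * t / δ)) ≤
      100 * Real.log (6 * t / δ) * (phi Q t k + psi Q B (b - a) t k δ) := by
  have hM : 0 ≤ b - a := sub_nonneg.mpr hab
  have hL := five_quarters_le_log_six_mul_div ht hδ
  rw [oracleTerm, psi]
  split_ifs with hsize
  · rw [hsize, Nat.cast_one, div_one, div_one]
    exact single_sample_oracleTerm_le phi_nonneg hM (popStd_le hab hB hp hQ hk) (by linarith)
  · exact bernstein_oracleTerm_le phi_nonneg (Real.sqrt_nonneg _) hM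
      (Nat.cast_pos.mpr (windowSize_pos hB hk)) hL (half_le_log_two_div hδ)

theorem three_mul_iInf_oracleTerm_le (ht : 1 ≤ t) (hab : a ≤ b)
    (hB : ∀ j ∈ Finset.Icc 1 t, 1 ≤ B j) (hp : ∀ j ∈ Finset.Icc 1 t, IsProbabilityMeasure (Q j))
    (hQ : ∀ j ∈ Finset.Icc 1 t, ∀ᵐ x ∂(Q j), x ∈ Set.Icc a b) (hδ : δ ∈ Set.Ioo (0 : ℝ) 1) :
    3 * ⨅ k : Finset.Icc 1 t, oracleTerm Q B (b - a) t k (Real.log (6 * t / δ)) ≤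
      100 * Real.log (6 * t / δ) *
        ⨅ k : Finset.Icc 1 t, (phi Q t k + psi Q B (b - a) t k δ) := by
  have hL := five_quarters_le_log_six_mul_div ht hδ
  rw [Real.mul_iInf_of_nonneg zero_le_three, Real.mul_iInf_of_nonneg (by linarith)]
  exact ciInf_mono (Set.finite_range _).bddBelow fun k =>
    three_mul_oracleTerm_le ht hab hB hp hQ hδ k.2

end Oracle

end RollingWindow

theorem mainTheorem1 :
    ∃ C : ℝ, 0 < C ∧
      ∀ {Ω : Type*} [MeasurableSpace Ω] (P : Measure Ω) [IsProbabilityMeasure P]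
        (a b : ℝ) (t : ℕ) (_ : 1 ≤ t)
        (B : ℕ → ℕ) (_ : ∀ j ∈ Finset.Icc 1 t, 1 ≤ B j)
        (Q : ℕ → Measure ℝ) (_ : ∀ j ∈ Finset.Icc 1 t, IsProbabilityMeasure (Q j))
        (_ : ∀ j ∈ Finset.Icc 1 t, ∀ᵐ x ∂(Q j), x ∈ Set.Icc a b)
        (u : ℕ → ℕ → Ω → ℝ)
        (_ : ∀ j ∈ Finset.Icc 1 t, ∀ i ∈ Finset.Icc 1 (B j), HasLaw (u j i) (Q j) P)
        (_ : iIndepFun (fun (p : RollingWindow.sampleIndex B t) => u p.1.1 p.1.2) P)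
        (δ : ℝ) (_ : δ ∈ Set.Ioo (0 : ℝ) 1),
        (1 - δ ≤ P.real {ω | ∀ k' ∈ RollingWindow.selectedWindows B (fun j i => u j i ω) (b - a) t
              (δ / (3 * t)),
            |RollingWindow.empMean B (fun j i => u j i ω) t k' - RollingWindow.popMean Q t| ≤
              C * Real.log (6 * t / δ) *
                ⨅ k : Finset.Icc 1 t,
                  (RollingWindow.phi Q t k + RollingWindow.psi Q B (b - a) t k δ)}) ∧
        (1 - δ ≤ P.real {ω | ∀ k' ∈ RollingWindow.selectedWindows B (fun j i => u j i ω) (b - a) t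
              (δ / (3 * t)),
            |RollingWindow.empMean B (fun j i => u j i ω) t k' - RollingWindow.popMean Q t| ≤
              3 * ⨅ k : Finset.Icc 1 t,
                (3 * √(Real.log (6 * t / δ)) * RollingWindow.phi Q t k
                  + RollingWindow.popStd Q B t k *
                      √(2 * Real.log (6 * t / δ) / RollingWindow.windowSize B t k)
                  + 10 * (b - a) * Real.log (6 * t / δ) / RollingWindow.windowSize B t k)}) := by
  refine ⟨100, by norm_num, ?_⟩
  intro Ω _ P _ a b t ht B hB Q hp hQ u hu hind δ hδ
  have hab : a ≤ b := by
    have htt : t ∈ Finset.Icc 1 t := Finset.right_mem_Icc.mpr ht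
    have := hp t htt
    obtain ⟨x, hx⟩ := (hQ t htt).exists
    exact hx.1.trans hx.2
  have hrefined :=
    RollingWindow.one_sub_le_measure_selected_le_oracleTerm ht hB hab hQ hu hind hδ
  refine ⟨hrefined.trans (measureReal_mono (Set.ofPred_subset_ofPred.mpr fun ω hω k' hk' => ?_)),
    hrefined⟩
  exact (hω k' hk').trans (RollingWindow.three_mul_iInf_oracleTerm_le ht hab hB hp hQ hδ)
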